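/- For real $x>0$ let $$\Theta(r,s,t,x)=\sum_{n=1}^{\infty}\sum_{m=1}^{\infty}\frac{1}{n^{r}m^{s}(n+mx)^{t}},$$ which converges absolutely for $\Re(r+t)>1$, $\Re(s+t)>1$, $\Re(r+s+t)>2$. For the integers $r,t$ below, $\Theta(r,s,t,x)$, as a function of $s$, continues meromorphically to $\mathbb{C}$, and this continuation is denoted by the same symbol. Let $\zeta$ be the Riemann zeta function, $\psi=\Gamma'/\Gamma$ the digamma function and $\psi^{(k)}$ its $k$-th derivative, $\gamma$ Euler's constant, $\gamma_1$ the first Stieltjes constant, normalised by $\zeta(s)=\frac1{s-1}+\gamma-\gamma_1(s-1)+O(|s-1|^2)$, and $H_n=\sum_{k=1}^n \frac1k$, $H_0=0$. Empty sums are $0$, and $\binom{c}{-1}=0$ for integers $c\ge 0$. (1) For all integers $r\ge 2$ and $t\ge 0$, the point $s=1-t$ is a simple pole of $\Theta(r,s,t,x)$ in $s$, and as $s\to 1-t$ $$\Theta(r,s,t,x)=\frac{x^{-t}\zeta(r)}{s-(1-t)}+\Bigg(\gamma\zeta(r)x^{-t}+(-1)^r\sum_{j=0}^{t-2}\binom{j+r-1}{j}\frac{(-1)^{t-j}}{(t-j-1)!}\frac{1}{x^{j+r}}\sum_{m=1}^{\infty}\frac{\psi^{(t-j-1)}(mx+1)}{m^{r+j-t+1}}$$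 $$\qquad+\sum_{i=1}^{r-2}\frac{(-1)^i}{x^{t+i}}\binom{i+t-1}{i}\zeta(i+1)\zeta(r-i)-\frac{(-1)^r}{x^{r+t-1}}\binom{r+t-2}{t-1}\sum_{m=1}^{\infty}\frac{\gamma+\psi(mx+1)}{m^{r}}\Bigg)+O(|s-(1-t)|).$$ (2) For $r=1$ and all integers $t\ge 1$, the point $s=1-t$ is a double pole of $\Theta(1,s,t,x)$ in $s$, and as $s\to 1-t$ $$\Theta(1,s,t,x)=\frac{x^{-t}}{(s-(1-t))^2}+\frac{x^{-t}}{s-(1-t)}\big(\gamma+\log x-H_{t-1}\big)+\Bigg(\frac{1}{x^{t}}\Big(\gamma\big(\gamma+\log x-H_{t-1}\big)+\gamma_1\Big)$$ $$\qquad-\sum_{j=0}^{t-2}\frac{(-1)^{t-j}x^{-j-1}}{(t-j-1)!}\sum_{m=1}^{\infty}\frac{\psi^{(t-j-1)}(mx)-(-1)^{t-j}(t-j-2)!\,(mx)^{-(t-j-1)}}{m^{j-t+2}}$$ $$\qquad+\frac{t\,\zeta(2)}{x^{t+1}}+\frac{1}{x^t}\sum_{m=1}^{\infty}\frac{\psi(mx)-\log(mx)}{m}\Bigg)+O(|s-(1-t)|).$$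 All the infinite series on the right-hand sides converge absolutely. -/

import Mathlib

open Filter Topology Asymptotics

noncomputable section

/-- The region `Re (r + t) > 1`, `Re (s + t) > 1`, `Re (r + s + t) > 2` of triples `(r, s, t)`. -/
def convergenceRegion : Set (ℂ × ℂ × ℂ) :=
  {p | 1 < (p.1 + p.2.2).re ∧ 1 < (p.2.1 + p.2.2).re ∧ 2 < (p.1 + p.2.1 + p.2.2).re}

/-- The term `1 / (n ^ r * m ^ s * (n + m x) ^ t)` of the double series, for `p = (n, m)`. -/
def thetaTerm (r s t : ℂ) (x : ℝ) (p : ℕ+ × ℕ+) : ℂ :=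
  1 / ((p.1 : ℂ) ^ r * (p.2 : ℂ) ^ s * ((p.1 : ℂ) + (p.2 : ℂ) * (x : ℂ)) ^ t)

/-- The double series `∑_{n ≥ 1} ∑_{m ≥ 1} 1 / (n ^ r * m ^ s * (n + m x) ^ t)`. -/
def thetaSeries (r s t : ℂ) (x : ℝ) : ℂ := ∑' p : ℕ+ × ℕ+, thetaTerm r s t x p

/-- `F` is the function `s ↦ Θ(r, s, t, x)`: it is meromorphic on the whole plane, and it is the sum
of the double series at every `s` with `(r, s, t)` in the region of convergence. -/
structure IsThetaContinuation (r t : ℂ) (x : ℝ) (F : ℂ → ℂ) : Prop where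
  meromorphic : Meromorphic F
  eq_series : ∀ s : ℂ, (r, s, t) ∈ convergenceRegion → F s = thetaSeries r s t x

/-- The polygamma function `ψ^(k)`, the `k`-th derivative of the digamma function. -/
def polygamma (k : ℕ) (z : ℂ) : ℂ := iteratedDeriv k Complex.digamma z

/-- The first Stieltjes constant `γ₁`, normalised by
`ζ(s) = 1 / (s - 1) + γ - γ₁ * (s - 1) + O((s - 1) ^ 2)` as `s → 1`. -/
def stieltjesOne : ℂ :=
  limUnder (𝓝[≠] (1 : ℂ)) fun s : ℂ =>
    (1 / (s - 1) + (Real.eulerMascheroniConstant : ℂ) - riemannZeta s) / (s - 1)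

/-- The binomial coefficient `binom (r + t - 2) (t - 1)` for `r ≥ 2` and `t ≥ 0`, which is `0` for
`t = 0`, where its lower entry is `-1` and its upper entry is non-negative. -/
def binomPred (r t : ℕ) : ℕ := if t = 0 then 0 else (r + t - 2).choose (t - 1)

end

/-! Summing over `n` first turns the double series into a Dirichlet series `∑ c(m) m ^ (-s)` with
`c(m) = ∑ 1 / (n ^ r (n + m x) ^ t)`. Partial fractions in `n`, with `y = m x`, write `c(m)` as a
finite combination of powers of `1 / m`, of `m ^ (-l) S_k(m x)` with `S_k(y) = ∑ 1 / (y + n) ^ k`,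
`k ≥ 2`, and of `m ^ (-l) h(m x)` with `h(y) = ∑ (1 / n - 1 / (y + n)) = ψ(y + 1) + γ`
(`pow_mul_pow_partialFraction`, `thetaCoeff_succ_eq`). Up to sign and a factorial, `S_k(y)` is a
polygamma value at `y + 1`.

Continuation. Telescoping `1 / y ^ p = ∑ (1 / (y + n - 1) ^ p - 1 / (y + n) ^ p)` and expanding each
difference in `1 / (y + n)` gives `1 / y ^ p = p S_{p+1}(y) + ∑ c_i S_i(y) + O(S_M(y))`, the sum
over `p + 2 ≤ i < M`. Solved for `S_{p+1}`, this trades it for a pure power, whose Dirichlet series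
is a shifted zeta function, for sums of higher index, and for a remainder as small as desired. The
same telescoping applied to the logarithm gives `h(y) = γ + log y + ∑ c_i S_i(y) + O(S_M(y))`, and
`log m` contributes `-ζ'`. Hence the Dirichlet series extends to every half-plane, and the
extensions glue.

Expansion at `s = 1 - t`. For `r ≥ 2` the only singular piece is `x ^ (-t) ζ(r) ζ(s + t)`;
everything else is analytic there, and its value gives the constant
(`thetaSeries_eq_riemannZeta_add`). For `r = 1` the `S_k` and `h` pieces sit on the edge of
convergence. Removing the leading terms `1 / ((k - 1) y ^ (k - 1))` and `γ + log y` produces `-ζ'(s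
+ t)` and `(γ + log x - H_{t-1}) ζ(s + t)`, and leaves series convergent at the point
(`thetaOneRegularPart`). Any continuation agrees with these formulas near `1 - t`, because that
point is a limit of points of convergence. -/

noncomputable section

/-! ### Shifted power sums and the expansion of inverse powers in them -/

/-- `∑_{n ≥ 1} 1 / (y + n) ^ k`. -/
def shiftedPowSum (k : ℕ) (y : ℝ) : ℝ := ∑' n : ℕ, 1 / (y + n + 1) ^ k

/-- `∑_{n ≥ 1} (1 / n - 1 / (y + n))`. -/
def shiftedHarmonic (y : ℝ) : ℝ := ∑' n : ℕ, (1 / ((n : ℝ) + 1) - 1 / (y + n + 1))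

lemma hasSum_telescope_inv_pow {p : ℕ} (hp : p ≠ 0) {y : ℝ} (hy : 0 < y) :
    HasSum (fun n : ℕ => 1 / (y + n) ^ p - 1 / (y + n + 1) ^ p) (1 / y ^ p) := by
  rw [hasSum_iff_tendsto_nat_of_nonneg]
  · have h1 : ∀ N : ℕ, ∑ n ∈ Finset.range N, (1 / (y + n) ^ p - 1 / (y + n + 1) ^ p)
        = 1 / y ^ p - 1 / (y + N) ^ p := by
      intro N
      have := Finset.sum_range_sub' (fun n : ℕ => 1 / (y + n) ^ p) N
      simp only [Nat.cast_add, Nat.cast_one, ← add_assoc, Nat.cast_zero, add_zero] at this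
      exact this
    simp_rw [h1]
    have h2 : Tendsto (fun N : ℕ => 1 / (y + N) ^ p) atTop (𝓝 0) := by
      have h3 : Tendsto (fun N : ℕ => y + (N : ℝ)) atTop atTop :=
        tendsto_atTop_add_const_left _ _ tendsto_natCast_atTop_atTop
      have h4 := (tendsto_pow_atTop hp).comp h3
      exact h4.inv_tendsto_atTop.congr fun N => by simp
    simpa using tendsto_const_nhds.sub h2
  · intro n
    have : 0 < y + n := by positivity
    exact sub_nonneg.2 (one_div_le_one_div_of_le (by positivity)
      (pow_le_pow_left₀ this.le (by linarith) p))

/-- A discrete form of comparison with an integral: summed along `a = y + n`, the right side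
telescopes, which gives both convergence of `S_{p+1}(y)` and the bound `y ^ (-p)`. -/
lemma inv_pow_succ_le_sub {p : ℕ} {a : ℝ} (ha : 0 < a) (hp : p ≠ 0) :
    1 / (a + 1) ^ (p + 1) ≤ 1 / a ^ p - 1 / (a + 1) ^ p := by
  obtain ⟨q, rfl⟩ := Nat.exists_eq_succ_of_ne_zero hp
  have h1 : 1 / a ^ (q + 1) ≥ 1 / (a * (a + 1) ^ q) := by
    rw [pow_succ']
    gcongr
    linarith
  have h2 : 1 / (a * (a + 1) ^ q) - 1 / (a + 1) ^ (q + 1) = 1 / (a * (a + 1) ^ (q + 1)) := by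
    field_simp
    ring
  have h3 : 1 / (a + 1) ^ (q + 1 + 1) ≤ 1 / (a * (a + 1) ^ (q + 1)) := by
    rw [pow_succ' _ (q + 1)]
    gcongr
    linarith
  simp only [Nat.succ_eq_add_one]
  linarith

lemma summable_shiftedPow {k : ℕ} (hk : 2 ≤ k) {y : ℝ} (hy : 0 < y) :
    Summable fun n : ℕ => 1 / (y + n + 1) ^ k := by
  obtain ⟨p, rfl⟩ : ∃ p, k = p + 1 := ⟨k - 1, by omega⟩
  refine Summable.of_nonneg_of_le (fun n => by positivity) (fun n => ?_)
    (hasSum_telescope_inv_pow (p := p) (by omega) hy).summable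
  exact inv_pow_succ_le_sub (by positivity) (by omega)

lemma shiftedPowSum_nonneg (k : ℕ) {y : ℝ} (hy : 0 < y) : 0 ≤ shiftedPowSum k y :=
  tsum_nonneg fun n => by positivity

lemma shiftedPowSum_le {p : ℕ} (hp : p ≠ 0) {y : ℝ} (hy : 0 < y) :
    shiftedPowSum (p + 1) y ≤ 1 / y ^ p := by
  rw [← (hasSum_telescope_inv_pow hp hy).tsum_eq]
  exact (summable_shiftedPow (by omega) hy).tsum_le_tsum
    (fun n => inv_pow_succ_le_sub (by positivity) hp) (hasSum_telescope_inv_pow hp hy).summable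

lemma summable_shiftedHarmonic {y : ℝ} (hy : 0 < y) :
    Summable fun n : ℕ => (1 / ((n : ℝ) + 1) - 1 / (y + n + 1)) := by
  have h := (summable_shiftedPow (k := 2) le_rfl (y := 1) one_pos).mul_left (y * 4)
  refine Summable.of_nonneg_of_le (fun n => ?_) (fun n => ?_) h
  · rw [sub_nonneg]
    gcongr
    linarith
  · have h1 : 1 / ((n : ℝ) + 1) - 1 / (y + n + 1) = y * (1 / ((n + 1) * (y + n + 1))) := by
      field_simp
      ring
    rw [h1, mul_assoc]
    gcongr
    rw [mul_one_div, div_le_div_iff₀ (by positivity) (by positivity)]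
    have : (0 : ℝ) ≤ n := by positivity
    nlinarith [mul_nonneg hy.le this]

/-- If `φ u = ∑ c i * u ^ i` with nonnegative coefficients, starting at `u ^ 2`, then the sum of
`φ (1 / (y + n))` over `n ≥ 1` expands in the functions `shiftedPowSum i`, uniformly in `y`. -/
lemma exists_bound_tsum_sub_sum_shiftedPowSum {c : ℕ → ℝ} (hc : ∀ i, 0 ≤ c i) (c0 : c 0 = 0)
    (c1 : c 1 = 0) {u₀ : ℝ} (hu₀ : 0 < u₀) {φ : ℝ → ℝ}
    (hφ : ∀ u, 0 < u → u ≤ u₀ → HasSum (fun i => c i * u ^ i) (φ u)) {M : ℕ} (hM : 2 ≤ M) :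
    ∃ C, ∀ y : ℝ, 0 < y → 1 / (y + 1) ≤ u₀ →
      |∑' n : ℕ, φ (1 / (y + n + 1)) - ∑ i ∈ Finset.range M, c i * shiftedPowSum i y|
        ≤ C * shiftedPowSum M y := by
  have hsum0 : Summable fun i => c (i + M) * u₀ ^ i := by
    have h1 := (summable_nat_add_iff M).2 (hφ u₀ hu₀ le_rfl).summable
    refine (h1.mul_left (u₀ ^ M)⁻¹).congr fun i => ?_
    rw [pow_add]
    field_simp
  -- For `0 < u ≤ u₀` and nonnegative `c`, the tail from index `M` is at most `u ^ M * ∑ c (i + M)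
  -- u₀ ^ i`; the constant therefore does not depend on `y`.
  refine ⟨∑' i, c (i + M) * u₀ ^ i, fun y hy hyu => ?_⟩
  set C := ∑' i, c (i + M) * u₀ ^ i
  set r : ℕ → ℝ := fun n => φ (1 / (y + n + 1)) - ∑ i ∈ Finset.range M, c i * (1 / (y + n + 1) ^ i)
    with hr
  have hrb : ∀ n, 0 ≤ r n ∧ r n ≤ C * (1 / (y + n + 1) ^ M) := by
    intro n
    set u := 1 / (y + n + 1) with hu
    have hupos : 0 < u := by positivity
    have hule : u ≤ u₀ := by
      refine le_trans ?_ hyu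
      rw [hu]
      gcongr
      have : (0 : ℝ) ≤ n := by positivity
      linarith
    have h := hφ u hupos hule
    have e : r n = ∑' i, c (i + M) * u ^ (i + M) := by
      have := h.summable.sum_add_tsum_nat_add M
      rw [h.tsum_eq] at this
      simp only [hr]
      rw [← this]
      simp only [hu, one_div, inv_pow]
      ring
    rw [e]
    refine ⟨tsum_nonneg fun i => mul_nonneg (hc _) (by positivity), ?_⟩
    have e2 : 1 / (y + n + 1) ^ M = u ^ M := by rw [hu]; simp
    rw [e2, ← tsum_mul_right]
    refine ((summable_nat_add_iff M).2 h.summable).tsum_le_tsum (fun i => ?_)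
      (hsum0.mul_right _)
    rw [pow_add, ← mul_assoc]
    have := hc (i + M)
    gcongr
  have hrs : Summable r := Summable.of_nonneg_of_le (fun n => (hrb n).1) (fun n => (hrb n).2)
    ((summable_shiftedPow hM hy).mul_left C)
  -- Indices `0` and `1` would give divergent sums; this is where `c 0 = c 1 = 0` is needed.
  have hterm : ∀ i, Summable fun n : ℕ => c i * (1 / (y + n + 1) ^ i) := by
    intro i
    match i with
    | 0 => simp [c0]
    | 1 => simp [c1]
    | (i + 2) => exact (summable_shiftedPow (by omega) hy).mul_left _
  have e3 : ∑' n : ℕ, φ (1 / (y + n + 1)) - ∑ i ∈ Finset.range M, c i * shiftedPowSum i y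
      = ∑' n, r n := by
    have : ∑ i ∈ Finset.range M, c i * shiftedPowSum i y
        = ∑' n : ℕ, ∑ i ∈ Finset.range M, c i * (1 / (y + n + 1) ^ i) := by
      rw [Summable.tsum_finsetSum fun i _ => hterm i]
      simp only [shiftedPowSum, tsum_mul_left]
    rw [this, sub_eq_iff_eq_add, ← hrs.tsum_add (summable_sum fun i _ => hterm i)]
    exact tsum_congr fun n => by simp [hr]
  rw [e3, abs_of_nonneg (tsum_nonneg fun n => (hrb n).1), shiftedPowSum, ← tsum_mul_left]
  exact hrs.tsum_le_tsum (fun n => (hrb n).2) ((summable_shiftedPow hM hy).mul_left C)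

/-- Expansion of `1 / y ^ p` in the functions `shiftedPowSum i`, with leading term
`p * shiftedPowSum (p + 1)`. -/
lemma exists_expansion_inv_pow {p : ℕ} (hp : p ≠ 0) {x : ℝ} (hx : 0 < x) {M : ℕ} (hM : p + 2 ≤ M) :
    ∃ (c : ℕ → ℝ) (C : ℝ), ∀ y : ℝ, x ≤ y →
      |1 / y ^ p - p * shiftedPowSum (p + 1) y
        - ∑ i ∈ Finset.Ico (p + 2) M, c i * shiftedPowSum i y| ≤ C * shiftedPowSum M y := by
  obtain ⟨k, rfl⟩ := Nat.exists_eq_succ_of_ne_zero hp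
  simp only [Nat.succ_eq_add_one] at *
  set c : ℕ → ℝ := fun i => if i ≤ k + 1 then 0 else ((i - (k + 1) + k).choose k : ℝ) with hcdef
  -- With `p = k + 1` and `u = 1 / (y + n + 1)` one has `y + n = (1 - u) / u`, so `φ u` is the
  -- telescoping difference `1 / (y + n) ^ p - 1 / (y + n + 1) ^ p`. Its coefficients `c` are those
  -- of the negative binomial series, shifted by `p` and without the constant term. For `y ≥ x`
  -- every `u` is at most `1 / (x + 1) < 1`.
  set φ : ℝ → ℝ := fun u => u ^ (k + 1) * (1 / (1 - u) ^ (k + 1) - 1) with hφdef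
  have hφ : ∀ u : ℝ, 0 < u → u ≤ 1 / (x + 1) → HasSum (fun i => c i * u ^ i) (φ u) := by
    intro u hu hux
    have hu1 : u < 1 := lt_of_le_of_lt hux (by rw [div_lt_one (by positivity)]; linarith)
    have hn : ‖u‖ < 1 := by rwa [Real.norm_of_nonneg hu.le]
    have h1 : HasSum (fun n : ℕ => ((n + k).choose k : ℝ) * u ^ n) (1 / (1 - u) ^ (k + 1)) := by
      rw [← tsum_choose_mul_geometric_of_norm_lt_one k hn]
      exact (summable_choose_mul_geometric_of_norm_lt_one k hn).hasSum
    have h2 := ((hasSum_nat_add_iff' 1).2 h1).mul_left (u ^ (k + 1))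
    rw [← hasSum_nat_add_iff' (k + 2)]
    have h3 : ∑ i ∈ Finset.range (k + 2), c i * u ^ i = 0 := by
      refine Finset.sum_eq_zero fun i hi => ?_
      have : i ≤ k + 1 := by have := Finset.mem_range.1 hi; omega
      simp [hcdef, this]
    rw [h3, sub_zero]
    have h6 : φ u = u ^ (k + 1) * (1 / (1 - u) ^ (k + 1)
        - ∑ i ∈ Finset.range 1, ((i + k).choose k : ℝ) * u ^ i) := by simp [hφdef]
    rw [h6]
    refine Eq.subst (motive := fun f => HasSum f _) (funext fun n => ?_) h2
    · have h4 : ¬ (n + (k + 2) ≤ k + 1) := by omega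
      have h5 : n + (k + 2) - (k + 1) + k = n + 1 + k := by omega
      simp only [hcdef, h4, if_false, h5]
      ring
  obtain ⟨C, hC⟩ := exists_bound_tsum_sub_sum_shiftedPowSum (c := c)
    (fun i => by simp only [hcdef]; split_ifs <;> positivity) (by simp [hcdef]) (by simp [hcdef])
    (u₀ := 1 / (x + 1)) (by positivity) hφ (M := M) (by omega)
  refine ⟨c, C, fun y hy => ?_⟩
  have hy0 : 0 < y := hx.trans_le hy
  have h := hC y hy0 (by gcongr)
  have e1 : ∑' n : ℕ, φ (1 / (y + n + 1)) = 1 / y ^ (k + 1) := by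
    rw [← (hasSum_telescope_inv_pow hp hy0).tsum_eq]
    refine tsum_congr fun n => ?_
    have hn : 0 < y + n := by positivity
    have : 1 - 1 / (y + n + 1) = (y + n) / (y + n + 1) := by field_simp; ring
    simp only [hφdef]
    rw [this, div_pow, div_pow, one_pow]
    field_simp
  have e2 : ∑ i ∈ Finset.range M, c i * shiftedPowSum i y
      = ((k + 1 : ℕ) : ℝ) * shiftedPowSum (k + 1 + 1) y
        + ∑ i ∈ Finset.Ico (k + 1 + 2) M, c i * shiftedPowSum i y := by
    rw [← Finset.sum_range_add_sum_Ico _ hM, Finset.sum_range_succ, Finset.sum_eq_zero, zero_add]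
    · congr 2
      have h5 : k + 1 + 1 - (k + 1) + k = k + 1 := by omega
      have h6 : ¬ (k + 1 + 1 ≤ k + 1) := by omega
      simp only [hcdef, h6, if_false, h5]
      simp
    · intro i hi
      have : i ≤ k + 1 := by have := Finset.mem_range.1 hi; omega
      simp [hcdef, this]
  rw [e1, e2] at h
  rwa [sub_sub]

/-! ### The shifted harmonic sum compared with the logarithm -/

lemma tendsto_log_add_sub_log (y : ℝ) :
    Tendsto (fun N : ℕ => Real.log (y + N) - Real.log N) atTop (𝓝 0) := by
  have h1 : Tendsto (fun N : ℕ => Real.log (y / N + 1)) atTop (𝓝 (Real.log (0 + 1))) :=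
    ((tendsto_const_div_atTop_nhds_zero_nat y).add_const 1).log (by norm_num)
  rw [zero_add, Real.log_one] at h1
  have h3 : Tendsto (fun N : ℕ => y + (N : ℝ)) atTop atTop :=
    tendsto_atTop_add_const_left _ _ tendsto_natCast_atTop_atTop
  refine h1.congr' ?_
  filter_upwards [eventually_ne_atTop 0, h3.eventually_gt_atTop 0] with N hN hN2
  have hN' : (N : ℝ) ≠ 0 := by exact_mod_cast hN
  rw [← Real.log_div hN2.ne' hN']
  congr 1
  field_simp

lemma log_ratio_sub_nonneg {a : ℝ} (ha : 0 < a) :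
    0 ≤ Real.log ((a + 1) / a) - 1 / (a + 1) := by
  have h := Real.log_le_sub_one_of_pos (x := a / (a + 1)) (by positivity)
  have e : a / (a + 1) = ((a + 1) / a)⁻¹ := by rw [inv_div]
  rw [e, Real.log_inv, ← e] at h
  have : a / (a + 1) - 1 = -(1 / (a + 1)) := by field_simp; ring
  linarith

/-- The logarithms telescope to `log (y + N) - log y`, and Euler's constant enters as the limit of
`H_N - log N`. In `u = 1 / (y + n + 1)` each term is `-log (1 - u) - u`, a power series starting at
`u ^ 2`. -/
lemma hasSum_log_ratio_sub {y : ℝ} (hy : 0 < y) :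
    HasSum (fun n : ℕ => Real.log ((y + n + 1) / (y + n)) - 1 / (y + n + 1))
      (shiftedHarmonic y - Real.eulerMascheroniConstant - Real.log y) := by
  rw [hasSum_iff_tendsto_nat_of_nonneg]
  · have h1 := ((((summable_shiftedHarmonic hy).hasSum.tendsto_sum_nat).sub
      Real.tendsto_harmonic_sub_log).add (tendsto_log_add_sub_log y)).sub_const (Real.log y)
    rw [add_zero] at h1
    refine h1.congr fun N => ?_
    have e1 : ∑ n ∈ Finset.range N, Real.log ((y + n + 1) / (y + n))
        = Real.log (y + N) - Real.log y := by
      have := Finset.sum_range_sub (fun n : ℕ => Real.log (y + n)) N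
      simp only [Nat.cast_add, Nat.cast_one, ← add_assoc, Nat.cast_zero, add_zero] at this
      rw [← this]
      refine Finset.sum_congr rfl fun n _ => ?_
      rw [Real.log_div (by positivity) (by positivity)]
    have e2 : (harmonic N : ℝ) = ∑ n ∈ Finset.range N, 1 / ((n : ℝ) + 1) := by
      simp [harmonic]
    rw [Finset.sum_sub_distrib, Finset.sum_sub_distrib, e1, e2]
    ring
  · intro n
    exact log_ratio_sub_nonneg (a := y + n) (by positivity)

lemma exists_expansion_shiftedHarmonic {x : ℝ} (hx : 0 < x) {M : ℕ} (hM : 2 ≤ M) :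
    ∃ (c : ℕ → ℝ) (C : ℝ), ∀ y : ℝ, x ≤ y →
      |shiftedHarmonic y - Real.eulerMascheroniConstant - Real.log y
        - ∑ i ∈ Finset.Ico 2 M, c i * shiftedPowSum i y| ≤ C * shiftedPowSum M y := by
  set c : ℕ → ℝ := fun i => if i ≤ 1 then 0 else 1 / (i : ℝ) with hcdef
  set φ : ℝ → ℝ := fun u => -Real.log (1 - u) - u with hφdef
  have hφ : ∀ u : ℝ, 0 < u → u ≤ 1 / (x + 1) → HasSum (fun i => c i * u ^ i) (φ u) := by
    intro u hu hux
    have hu1 : u < 1 := lt_of_le_of_lt hux (by rw [div_lt_one (by positivity)]; linarith)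
    have h1 := Real.hasSum_pow_div_log_of_abs_lt_one (x := u) (by rwa [abs_of_nonneg hu.le])
    have h2 := (hasSum_nat_add_iff' 1).2 h1
    rw [← hasSum_nat_add_iff' 2]
    have h3 : ∑ i ∈ Finset.range 2, c i * u ^ i = 0 := by
      simp [hcdef, Finset.sum_range_succ]
    rw [h3, sub_zero]
    convert h2 using 1
    · funext n
      simp only [hcdef, show ¬ (n + 2 ≤ 1) by omega, if_false]
      push_cast
      ring
    · simp [hφdef]
  obtain ⟨C, hC⟩ := exists_bound_tsum_sub_sum_shiftedPowSum (c := c)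
    (fun i => by simp only [hcdef]; split_ifs <;> positivity) (by simp [hcdef]) (by simp [hcdef])
    (u₀ := 1 / (x + 1)) (by positivity) hφ hM
  refine ⟨c, C, fun y hy => ?_⟩
  have hy0 : 0 < y := hx.trans_le hy
  have h := hC y hy0 (by gcongr)
  have e1 : ∑' n : ℕ, φ (1 / (y + n + 1))
      = shiftedHarmonic y - Real.eulerMascheroniConstant - Real.log y := by
    rw [← (hasSum_log_ratio_sub hy0).tsum_eq]
    refine tsum_congr fun n => ?_
    have hn : 0 < y + n := by positivity
    have : 1 - 1 / (y + n + 1) = ((y + n + 1) / (y + n))⁻¹ := by field_simp; ring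
    simp only [hφdef, this, Real.log_inv, neg_neg]
  have e2 : ∑ i ∈ Finset.range M, c i * shiftedPowSum i y
      = ∑ i ∈ Finset.Ico 2 M, c i * shiftedPowSum i y := by
    rw [← Finset.sum_range_add_sum_Ico _ hM]
    simp [hcdef, Finset.sum_range_succ]
  rwa [e1, e2] at h

/-! ### Digamma at positive reals through convexity of `log Γ` -/

lemma hasDerivAt_log_Gamma {y : ℝ} (hy : 0 < y) :
    HasDerivAt (Real.log ∘ Real.Gamma) (deriv Real.Gamma y / Real.Gamma y) y :=
  ((Real.differentiableAt_Gamma fun m => by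
    have : (0 : ℝ) ≤ m := by positivity
    linarith).hasDerivAt).log (Real.Gamma_pos_of_pos hy).ne'

/-- Passing to the real function `log Γ` makes its convexity available. -/
lemma digamma_ofReal {y : ℝ} (hy : 0 < y) :
    Complex.digamma (y : ℂ) = ((deriv (Real.log ∘ Real.Gamma) y : ℝ) : ℂ) := by
  have hd : DifferentiableAt ℝ Real.Gamma y := Real.differentiableAt_Gamma fun m => by
    have : (0 : ℝ) ≤ m := by positivity
    linarith
  have hc : DifferentiableAt ℂ Complex.Gamma (y : ℂ) :=
    Complex.differentiableAt_Gamma _ fun m h => by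
      have h1 := congrArg Complex.re h
      have : (0 : ℝ) ≤ m := by positivity
      simp at h1
      linarith
  have h1 := hc.hasDerivAt.comp_ofReal
  have h2 := hd.hasDerivAt.ofReal_comp
  simp only [Complex.Gamma_ofReal] at h1
  rw [(hasDerivAt_log_Gamma hy).deriv, Complex.digamma_def, logDeriv_apply, Complex.Gamma_ofReal,
    h1.unique h2, Complex.ofReal_div]

lemma digamma_add_one_ofReal {y : ℝ} (hy : 0 < y) :
    Complex.digamma ((y : ℂ) + 1) = Complex.digamma y + 1 / y := by
  rw [Complex.digamma_apply_add_one, one_div]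
  intro m h
  have h1 := congrArg Complex.re h
  have : (0 : ℝ) ≤ m := by positivity
  simp at h1
  linarith

lemma deriv_log_Gamma_add_one {y : ℝ} (hy : 0 < y) :
    deriv (Real.log ∘ Real.Gamma) (y + 1) = deriv (Real.log ∘ Real.Gamma) y + 1 / y := by
  have h := digamma_add_one_ofReal hy
  have h1 := digamma_ofReal (y := y + 1) (by positivity)
  rw [digamma_ofReal hy] at h
  push_cast at h1
  rw [h1] at h
  exact_mod_cast h

/-- By `Γ(y + 1) = y Γ(y)`, the slope of `log Γ` over `[y, y + 1]` is exactly `log y`; convexity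
places it between the derivatives at the two endpoints. -/
lemma deriv_log_Gamma_le {y : ℝ} (hy : 0 < y) :
    deriv (Real.log ∘ Real.Gamma) y ≤ Real.log y ∧
      Real.log y ≤ deriv (Real.log ∘ Real.Gamma) (y + 1) := by
  have hs : slope (Real.log ∘ Real.Gamma) y (y + 1) = Real.log y := by
    simp only [slope, Function.comp_apply, add_sub_cancel_left, inv_one, vsub_eq_sub, one_smul]
    rw [Real.Gamma_add_one hy.ne', Real.log_mul hy.ne' (Real.Gamma_pos_of_pos hy).ne']
    ring
  have hy1 : 0 < y + 1 := by positivity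
  constructor
  · rw [← hs]
    exact Real.convexOn_log_Gamma.deriv_le_slope hy hy1 (by linarith)
      (hasDerivAt_log_Gamma hy).differentiableAt
  · rw [← hs]
    exact Real.convexOn_log_Gamma.slope_le_deriv hy hy1 (by linarith)
      (hasDerivAt_log_Gamma hy1).differentiableAt

lemma tendsto_deriv_log_Gamma_sub_log {y : ℝ} (hy : 0 < y) :
    Tendsto (fun N : ℕ => deriv (Real.log ∘ Real.Gamma) (y + N) - Real.log (y + N)) atTop (𝓝 0) := by
  have h3 : Tendsto (fun N : ℕ => y + (N : ℝ)) atTop atTop :=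
    tendsto_atTop_add_const_left _ _ tendsto_natCast_atTop_atTop
  have h4 : Tendsto (fun N : ℕ => -(1 / (y + N))) atTop (𝓝 0) := by
    have := h3.inv_tendsto_atTop.neg
    rw [neg_zero] at this
    exact this.congr fun N => by simp
  refine tendsto_of_tendsto_of_tendsto_of_le_of_le h4 tendsto_const_nhds (fun N => ?_) fun N => ?_
  · have hp : 0 < y + N := by positivity
    have h1 := (deriv_log_Gamma_le hp).2
    have h2 := deriv_log_Gamma_add_one hp
    simp only
    linarith
  · have hp : 0 < y + N := by positivity
    have h1 := (deriv_log_Gamma_le hp).1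
    simp only
    linarith

/-- The recurrence moves the argument out to `y + 1 + N`, where the derivative differs from the
logarithm by `o(1)`; comparison with `H_N - log N → γ` identifies the constant. -/
lemma deriv_log_Gamma_eq {y : ℝ} (hy : 0 < y) :
    deriv (Real.log ∘ Real.Gamma) (y + 1) = shiftedHarmonic y - Real.eulerMascheroniConstant := by
  have hsum : ∀ N : ℕ, deriv (Real.log ∘ Real.Gamma) (y + 1 + N)
      = deriv (Real.log ∘ Real.Gamma) (y + 1) + ∑ n ∈ Finset.range N, 1 / (y + n + 1) := by
    intro N
    induction N with
    | zero => simp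
    | succ N ih =>
      have h := deriv_log_Gamma_add_one (y := y + 1 + N) (by positivity)
      rw [Finset.sum_range_succ, ← add_assoc, ← ih, Nat.cast_succ, ← add_assoc, h]
      congr 2
      ring
  have h1 := (summable_shiftedHarmonic hy).hasSum.tendsto_sum_nat
  have h2 := ((Real.tendsto_harmonic_sub_log.sub (tendsto_log_add_sub_log (y + 1))).sub
    (tendsto_deriv_log_Gamma_sub_log (y := y + 1) (by positivity))).add_const
      (deriv (Real.log ∘ Real.Gamma) (y + 1))
  have h3 := tendsto_nhds_unique h1 (h2.congr fun N => ?_)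
  · rw [shiftedHarmonic, h3]
    ring
  · have e2 : (harmonic N : ℝ) = ∑ n ∈ Finset.range N, 1 / ((n : ℝ) + 1) := by
      simp [harmonic]
    rw [hsum, Finset.sum_sub_distrib, e2]
    ring

lemma digamma_add_one_eq {y : ℝ} (hy : 0 < y) :
    Complex.digamma ((y : ℂ) + 1)
      = (shiftedHarmonic y : ℂ) - (Real.eulerMascheroniConstant : ℂ) := by
  have h := digamma_ofReal (y := y + 1) (by positivity)
  rw [deriv_log_Gamma_eq hy] at h
  push_cast at h
  exact h

/-! ### Series for the polygamma functions on the right half-plane -/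

lemma isOpen_lt_re (a : ℝ) : IsOpen {z : ℂ | a < z.re} :=
  isOpen_lt continuous_const Complex.continuous_re

lemma isPreconnected_lt_re (a : ℝ) : IsPreconnected {z : ℂ | a < z.re} :=
  (convex_halfSpace_re_gt a).isPreconnected

lemma natCast_add_ne_zero {z : ℂ} (hz : 0 < z.re) (n : ℕ) : (n : ℂ) + z ≠ 0 := by
  intro h
  have h1 := congrArg Complex.re h
  have : (0 : ℝ) ≤ n := by positivity
  simp at h1
  linarith

lemma norm_inv_natCast_add_pow_le {δ : ℝ} (hδ : 0 < δ) {z : ℂ} (hz : δ < z.re) (n k : ℕ) :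
    ‖1 / ((n : ℂ) + z) ^ k‖ ≤ 1 / ((n : ℝ) + δ) ^ k := by
  rw [norm_div, norm_one, norm_pow]
  gcongr
  calc (n : ℝ) + δ ≤ ((n : ℂ) + z).re := by simp; linarith
    _ ≤ _ := Complex.re_le_norm _

lemma summable_inv_natCast_add_pow {δ : ℝ} (hδ : 0 < δ) {k : ℕ} (hk : 2 ≤ k) :
    Summable fun n : ℕ => 1 / ((n : ℝ) + δ) ^ k := by
  rw [← summable_nat_add_iff 1]
  refine (summable_shiftedPow hk hδ).congr fun n => ?_
  push_cast
  congr 2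
  ring

lemma hasDerivAt_inv_natCast_add_pow {z : ℂ} (hz : 0 < z.re) (n k : ℕ) :
    HasDerivAt (fun z : ℂ => 1 / ((n : ℂ) + z) ^ k) (-(k * (1 / ((n : ℂ) + z) ^ (k + 1)))) z := by
  have h0 := natCast_add_ne_zero hz n
  have h1 : HasDerivAt (fun z : ℂ => (n : ℂ) + z) 1 z := (hasDerivAt_id z).const_add _
  have h2 := (h1.fun_pow k).inv (pow_ne_zero _ h0)
  simp only [one_div]
  refine h2.congr_deriv ?_
  rcases k with _ | k
  · simp
  · simp only [Nat.add_sub_cancel]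
    field_simp
    ring

/-- `∑_{n ≥ 0} 1 / (n + z) ^ k`. -/
def hurwitzPow (k : ℕ) (z : ℂ) : ℂ := ∑' n : ℕ, 1 / ((n : ℂ) + z) ^ k

lemma hasDerivAt_hurwitzPow {k : ℕ} (hk : 2 ≤ k) {z : ℂ} (hz : 0 < z.re) :
    HasDerivAt (hurwitzPow k) (-(k * hurwitzPow (k + 1) z)) z := by
  have hδ : 0 < z.re / 2 := by positivity
  have hmem : z ∈ {w : ℂ | z.re / 2 < w.re} := by simp; linarith
  have h := hasDerivAt_tsum_of_isPreconnected (𝕜 := ℂ)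
    ((summable_inv_natCast_add_pow hδ (k := k + 1) (by omega)).mul_left (k : ℝ))
    (isOpen_lt_re (z.re / 2)) (isPreconnected_lt_re _)
    (fun n w hw => hasDerivAt_inv_natCast_add_pow (hδ.trans hw) n k)
    (fun n w hw => by
      rw [norm_neg, norm_mul, Complex.norm_natCast]
      gcongr
      exact norm_inv_natCast_add_pow_le hδ hw n (k + 1))
    hmem
    (Summable.of_norm_bounded (summable_inv_natCast_add_pow hδ hk)
      fun n => norm_inv_natCast_add_pow_le hδ hmem n k) hmem
  simp only [tsum_neg, tsum_mul_left] at h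
  exact h

/-- `-γ + ∑_{n ≥ 0} (1 / (n + 1) - 1 / (n + z))`. -/
def digammaSeries (z : ℂ) : ℂ :=
  -(Real.eulerMascheroniConstant : ℂ) + ∑' n : ℕ, (1 / ((n : ℂ) + 1) - 1 / ((n : ℂ) + z))

lemma summable_digammaSeries_one :
    Summable fun n : ℕ => (1 / ((n : ℂ) + 1) - 1 / ((n : ℂ) + 1)) := by
  simp

lemma hasDerivAt_digammaSeries {z : ℂ} (hz : 0 < z.re) :
    HasDerivAt digammaSeries (hurwitzPow 2 z) z := by
  -- `δ < 1` keeps the point `1` in the half-plane: there every term of the series vanishes, so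
  -- convergence at one point is free.
  obtain ⟨δ, hδ, hδz, hδ1⟩ : ∃ δ : ℝ, 0 < δ ∧ δ < z.re ∧ δ < 1 :=
    ⟨min z.re 1 / 2, by positivity, by
      have := min_le_left z.re 1
      linarith, by
      have := min_le_right z.re 1
      linarith⟩
  have h := hasDerivAt_tsum_of_isPreconnected (𝕜 := ℂ)
    (g := fun (n : ℕ) (z : ℂ) => 1 / ((n : ℂ) + 1) - 1 / ((n : ℂ) + z))
    (g' := fun (n : ℕ) (z : ℂ) => 1 / ((n : ℂ) + z) ^ 2)
    (summable_inv_natCast_add_pow hδ (k := 2) le_rfl)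
    (isOpen_lt_re δ) (isPreconnected_lt_re _)
    (fun n w hw => by
      have := (hasDerivAt_inv_natCast_add_pow (hδ.trans hw) n 1).const_sub (1 / ((n : ℂ) + 1))
      simpa using this)
    (fun n w hw => norm_inv_natCast_add_pow_le hδ hw n 2)
    (y₀ := 1) (by simpa using hδ1) summable_digammaSeries_one (y := z) hδz
  exact h.const_add _

lemma digamma_eq_digammaSeries_ofReal {y : ℝ} (hy : 0 < y) :
    Complex.digamma ((y : ℂ) + 1) = digammaSeries ((y : ℂ) + 1) := by
  rw [digamma_add_one_eq hy, digammaSeries, shiftedHarmonic, Complex.ofReal_tsum]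
  have : ∀ n : ℕ, (((1 / ((n : ℝ) + 1) - 1 / (y + n + 1) : ℝ)) : ℂ)
      = 1 / ((n : ℂ) + 1) - 1 / ((n : ℂ) + ((y : ℂ) + 1)) := by
    intro n
    push_cast
    congr 2
    ring
  simp_rw [this]
  ring

/-- Complex derivatives of `ψ` require the series on an open set, not only on the real axis. The
identity theorem supplies this from the real points `2 + 1 / (n + 1)`, which accumulate at `2`. -/
lemma digamma_eqOn_digammaSeries :
    Set.EqOn Complex.digamma digammaSeries {z : ℂ | 0 < z.re} := by
  have hG : DifferentiableOn ℂ Complex.Gamma {z : ℂ | 0 < z.re} := fun z hz =>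
    (Complex.differentiableAt_Gamma _ fun m h => by
      have h1 := congrArg Complex.re h
      have : (0 : ℝ) ≤ m := by positivity
      have : 0 < z.re := hz
      simp at h1
      linarith).differentiableWithinAt
  have h1 : AnalyticOnNhd ℂ Complex.digamma {z : ℂ | 0 < z.re} := by
    have := hG.analyticOnNhd (isOpen_lt_re 0)
    rw [Complex.digamma_def]
    exact this.deriv.div this fun z hz => Complex.Gamma_ne_zero_of_re_pos hz
  have h2 : AnalyticOnNhd ℂ digammaSeries {z : ℂ | 0 < z.re} :=
    DifferentiableOn.analyticOnNhd
      (fun z hz => (hasDerivAt_digammaSeries hz).differentiableAt.differentiableWithinAt)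
      (isOpen_lt_re 0)
  refine h1.eqOn_of_preconnected_of_frequently_eq h2 (isPreconnected_lt_re 0) (z₀ := 2)
    (by simp) ?_
  have ht : Tendsto (fun n : ℕ => (2 : ℂ) + ((1 / ((n : ℝ) + 1) : ℝ) : ℂ)) atTop (𝓝[≠] 2) := by
    refine tendsto_nhdsWithin_iff.2 ⟨?_, ?_⟩
    · have := (Complex.continuous_ofReal.tendsto 0).comp tendsto_one_div_add_atTop_nhds_zero_nat
      simpa [Function.comp_def] using this.const_add 2
    · refine Eventually.of_forall fun n => ?_
      have : (((1 / ((n : ℝ) + 1) : ℝ)) : ℂ) ≠ 0 := by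
        have : 0 < 1 / ((n : ℝ) + 1) := by positivity
        exact_mod_cast this.ne'
      simpa using this
  refine ht.frequently (Frequently.of_forall fun n => ?_)
  have := digamma_eq_digammaSeries_ofReal (y := 1 + 1 / ((n : ℝ) + 1)) (by positivity)
  have e : (((1 + 1 / ((n : ℝ) + 1) : ℝ)) : ℂ) + 1 = 2 + ((1 / ((n : ℝ) + 1) : ℝ) : ℂ) := by
    push_cast
    ring
  rwa [e] at this

lemma polygamma_eqOn (k : ℕ) :
    Set.EqOn (polygamma (k + 1))
      (fun z => (-1) ^ k * ((k + 1).factorial : ℂ) * hurwitzPow (k + 2) z) {z : ℂ | 0 < z.re} := by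
  induction k with
  | zero =>
    intro z hz
    have h : Complex.digamma =ᶠ[𝓝 z] digammaSeries :=
      digamma_eqOn_digammaSeries.eventuallyEq_of_mem ((isOpen_lt_re 0).mem_nhds hz)
    simp [polygamma, h.deriv_eq, (hasDerivAt_digammaSeries hz).deriv]
  | succ k ih =>
    intro z hz
    have h := ih.eventuallyEq_of_mem ((isOpen_lt_re 0).mem_nhds hz)
    rw [polygamma, iteratedDeriv_succ]
    change deriv (polygamma (k + 1)) z = _
    rw [h.deriv_eq,
      ((hasDerivAt_hurwitzPow (k := k + 2) (by omega) hz).const_mul _).deriv,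
      Nat.factorial_succ (k + 1)]
    push_cast
    ring

lemma hurwitzPow_add_one (k : ℕ) (y : ℝ) :
    hurwitzPow k ((y : ℂ) + 1) = (shiftedPowSum k y : ℂ) := by
  rw [hurwitzPow, shiftedPowSum, Complex.ofReal_tsum]
  refine tsum_congr fun n => ?_
  push_cast
  congr 2
  ring

lemma hurwitzPow_ofReal {k : ℕ} (hk : 2 ≤ k) {y : ℝ} (hy : 0 < y) :
    hurwitzPow k (y : ℂ) = 1 / (y : ℂ) ^ k + (shiftedPowSum k y : ℂ) := by
  have hs : Summable fun n : ℕ => 1 / ((n : ℂ) + (y : ℂ)) ^ k :=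
    Summable.of_norm_bounded (summable_inv_natCast_add_pow (δ := y / 2) (by positivity) hk)
      fun n => norm_inv_natCast_add_pow_le (by positivity) (by simp; linarith) n k
  rw [hurwitzPow, hs.tsum_eq_zero_add, ← hurwitzPow_add_one, hurwitzPow]
  congr 1
  · simp
  · refine tsum_congr fun n => ?_
    push_cast
    congr 2
    ring

lemma polygamma_add_one_ofReal (k : ℕ) {y : ℝ} (hy : 0 < y) :
    polygamma (k + 1) ((y : ℂ) + 1)
      = (-1) ^ k * ((k + 1).factorial : ℂ) * (shiftedPowSum (k + 2) y : ℂ) := by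
  have h : ((y : ℂ) + 1) ∈ {z : ℂ | 0 < z.re} := by simp; linarith
  rw [polygamma_eqOn k h, ← hurwitzPow_add_one]

lemma polygamma_ofReal (k : ℕ) {y : ℝ} (hy : 0 < y) :
    polygamma (k + 1) (y : ℂ) = (-1) ^ k * ((k + 1).factorial : ℂ)
      * (1 / (y : ℂ) ^ (k + 2) + (shiftedPowSum (k + 2) y : ℂ)) := by
  have h : (y : ℂ) ∈ {z : ℂ | 0 < z.re} := by simpa using hy
  rw [polygamma_eqOn k h]
  simp only [hurwitzPow_ofReal (k := k + 2) (by omega) hy]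

/-! ### Zeta near `1` and elementary Dirichlet series -/

/-- `ζ s - 1 / (s - 1)`, extended to `s = 1` by Euler's constant. -/
def zetaRegular : ℂ → ℂ :=
  Function.update (fun s => riemannZeta s - 1 / (s - 1)) 1 (Real.eulerMascheroniConstant : ℂ)

lemma zetaRegular_one : zetaRegular 1 = (Real.eulerMascheroniConstant : ℂ) := by
  simp [zetaRegular]

lemma riemannZeta_eq_add_zetaRegular {s : ℂ} (hs : s ≠ 1) :
    riemannZeta s = 1 / (s - 1) + zetaRegular s := by
  simp [zetaRegular, hs]

lemma analyticAt_zetaRegular_one : AnalyticAt ℂ zetaRegular 1 := by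
  refine Complex.analyticAt_of_differentiable_on_punctured_nhds_of_continuousAt ?_
    (continuousAt_update_same.2 tendsto_riemannZeta_sub_one_div)
  filter_upwards [self_mem_nhdsWithin] with s hs
  have hs1 : s ≠ 1 := hs
  have h1 : DifferentiableAt ℂ (fun s => riemannZeta s - 1 / (s - 1)) s :=
    (differentiableAt_riemannZeta hs1).sub
      ((differentiableAt_const _).div (by fun_prop) (sub_ne_zero.2 hs1))
  refine h1.congr_of_eventuallyEq ?_
  filter_upwards [isOpen_ne.mem_nhds hs1] with w hw
  simp [zetaRegular, hw]

lemma analyticAt_riemannZeta {s : ℂ} (hs : s ≠ 1) : AnalyticAt ℂ riemannZeta s :=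
  DifferentiableOn.analyticAt (s := {1}ᶜ)
    (fun _ hw => (differentiableAt_riemannZeta hw).differentiableWithinAt)
    (isOpen_ne.mem_nhds hs)

lemma meromorphic_riemannZeta : Meromorphic riemannZeta := by
  intro s
  by_cases hs : s = 1
  · subst hs
    have h1 : MeromorphicAt (fun s : ℂ => 1 / (s - 1) + zetaRegular s) 1 := by
      have := analyticAt_zetaRegular_one.meromorphicAt
      fun_prop
    refine h1.congr ?_
    filter_upwards [self_mem_nhdsWithin] with w hw
    exact (riemannZeta_eq_add_zetaRegular hw).symm
  · exact (analyticAt_riemannZeta hs).meromorphicAt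

/-- A factor `m ^ (-k)` only shifts the variable, so each piece of the coefficient reduces to the
series of `1`, `log m`, `S_k(m x)` or `h(m x)`. -/
lemma LSeries_term_inv_pow_mul (g : ℕ → ℂ) (k : ℕ) (s : ℂ) :
    LSeries.term (fun m => ((m : ℂ) ^ k)⁻¹ * g m) s = LSeries.term g (s + k) := by
  funext m
  rcases eq_or_ne m 0 with rfl | hm
  · simp
  · have hm' : (m : ℂ) ≠ 0 := by exact_mod_cast hm
    rw [LSeries.term_of_ne_zero hm, LSeries.term_of_ne_zero hm, Complex.cpow_add _ _ hm',
      Complex.cpow_natCast]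
    field_simp

lemma LSeriesHasSum_inv_pow_mul {g : ℕ → ℂ} {k : ℕ} {s a : ℂ} :
    LSeriesHasSum (fun m => ((m : ℂ) ^ k)⁻¹ * g m) s a ↔ LSeriesHasSum g (s + k) a := by
  rw [LSeriesHasSum, LSeries_term_inv_pow_mul, LSeriesHasSum]

lemma LSeriesHasSum_inv_pow {k : ℕ} {s : ℂ} (hs : 1 < (s + k).re) :
    LSeriesHasSum (fun m => ((m : ℂ) ^ k)⁻¹) s (riemannZeta (s + k)) := by
  have h := LSeriesHasSum_inv_pow_mul (k := k).2 (LSeriesHasSum_one hs)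
  simpa using h

lemma LSeriesHasSum_log {s : ℂ} (hs : 1 < s.re) :
    LSeriesHasSum (fun m => Complex.log m) s (-deriv riemannZeta s) := by
  have h1 : LSeries.abscissaOfAbsConv 1 < s.re := by
    rw [LSeries.abscissaOfAbsConv_one]
    exact_mod_cast hs
  have h2 := (LSeriesSummable_logMul_of_lt_re h1).LSeriesHasSum
  have h3 := LSeries_deriv h1
  have h4 : LSeries 1 =ᶠ[𝓝 s] riemannZeta := by
    filter_upwards [(isOpen_lt_re 1).mem_nhds hs] with w hw
    exact LSeries_one_eq_riemannZeta hw
  rw [h4.deriv_eq] at h3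
  rw [h3, neg_neg]
  have h5 : LSeries.logMul 1 = fun m : ℕ => Complex.log m := by
    funext m
    simp [LSeries.logMul]
  rwa [h5] at h2 ⊢

lemma LSeriesHasSum_inv_pow_mul_log {k : ℕ} {s : ℂ} (hs : 1 < (s + k).re) :
    LSeriesHasSum (fun m => ((m : ℂ) ^ k)⁻¹ * Complex.log m) s (-deriv riemannZeta (s + k)) :=
  LSeriesHasSum_inv_pow_mul.2 (LSeriesHasSum_log hs)

lemma abscissaOfAbsConv_lt_re_of_bound {g : ℕ → ℂ} {a C : ℝ}
    (hg : ∀ m : ℕ, m ≠ 0 → ‖g m‖ ≤ C * (m : ℝ) ^ a) {s : ℂ} (hs : a + 1 < s.re) :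
    LSeries.abscissaOfAbsConv g < s.re :=
  (LSeries.abscissaOfAbsConv_le_of_le_const_mul_rpow ⟨C, hg⟩).trans_lt (by exact_mod_cast hs)

lemma analyticAt_LSeries_of_bound {g : ℕ → ℂ} {a C : ℝ}
    (hg : ∀ m : ℕ, m ≠ 0 → ‖g m‖ ≤ C * (m : ℝ) ^ a) {s : ℂ} (hs : a + 1 < s.re) :
    AnalyticAt ℂ (LSeries g) s :=
  LSeries_analyticOnNhd g s (abscissaOfAbsConv_lt_re_of_bound hg hs)

lemma LSeriesHasSum_of_bound {g : ℕ → ℂ} {a C : ℝ}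
    (hg : ∀ m : ℕ, m ≠ 0 → ‖g m‖ ≤ C * (m : ℝ) ^ a) {s : ℂ} (hs : a + 1 < s.re) :
    LSeriesHasSum g s (LSeries g s) :=
  (LSeriesSummable_of_abscissaOfAbsConv_lt_re
    (abscissaOfAbsConv_lt_re_of_bound hg hs)).LSeriesHasSum

/-! ### Extension of Dirichlet series to half-planes -/

/-- The Dirichlet series of `g` converges absolutely for `Re s > A`, and continues from there
meromorphically to the half-plane `Re s > -N`. -/
def HasMeromorphicExtension (N A : ℝ) (g : ℕ → ℂ) : Prop :=
  ∃ F : ℂ → ℂ, MeromorphicOn F {s | -N < s.re} ∧ ∀ s : ℂ, A < s.re → LSeriesHasSum g s (F s)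

lemma le_natCast_mul {x : ℝ} (hx : 0 < x) {m : ℕ} (hm : m ≠ 0) : x ≤ m * x := by
  have : (1 : ℝ) ≤ m := by exact_mod_cast Nat.one_le_iff_ne_zero.2 hm
  nlinarith

namespace HasMeromorphicExtension

variable {N A : ℝ} {f g : ℕ → ℂ}

lemma congr (hf : HasMeromorphicExtension N A f) (h : ∀ m ≠ 0, f m = g m) :
    HasMeromorphicExtension N A g := by
  obtain ⟨F, hF, hs⟩ := hf
  exact ⟨F, hF, fun s h' => (LSeriesHasSum_congr s _ (fun {m} hm => h m hm)).1 (hs s h')⟩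

lemma add (hf : HasMeromorphicExtension N A f) (hg : HasMeromorphicExtension N A g) :
    HasMeromorphicExtension N A (f + g) := by
  obtain ⟨F, hF, hs⟩ := hf
  obtain ⟨G, hG, hs'⟩ := hg
  exact ⟨F + G, hF.add hG, fun s h => (hs s h).add (hs' s h)⟩

lemma smul (c : ℂ) (hf : HasMeromorphicExtension N A f) :
    HasMeromorphicExtension N A (c • f) := by
  obtain ⟨F, hF, hs⟩ := hf
  refine ⟨fun s => c * F s, fun s h => (MeromorphicAt.const c s).mul (hF s h), fun s h => ?_⟩
  exact (hs s h).smul c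

lemma sum {ι : Type*} {S : Finset ι} {f : ι → ℕ → ℂ}
    (hf : ∀ i ∈ S, HasMeromorphicExtension N A (f i)) :
    HasMeromorphicExtension N A (∑ i ∈ S, f i) := by
  classical
  induction S using Finset.induction_on with
  | empty =>
    refine ⟨fun _ => 0, fun s _ => MeromorphicAt.const 0 s, fun s _ => ?_⟩
    have h0 : LSeries.term 0 s = fun _ => 0 := by
      funext m
      simp [LSeries.term]
    rw [LSeriesHasSum, Finset.sum_empty, h0]
    exact hasSum_zero
  | insert i S hi ih =>
    rw [Finset.sum_insert hi]
    exact (hf i (Finset.mem_insert_self _ _)).add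
      (ih fun j hj => hf j (Finset.mem_insert_of_mem hj))

lemma of_bound {C : ℝ} {q : ℕ} (hg : ∀ m : ℕ, m ≠ 0 → ‖g m‖ ≤ C * (1 / (m : ℝ) ^ q))
    (hN : 1 - q ≤ -N) (hA : 1 - q ≤ A) : HasMeromorphicExtension N A g := by
  have hg' : ∀ m : ℕ, m ≠ 0 → ‖g m‖ ≤ C * (m : ℝ) ^ (-(q : ℝ)) := by
    intro m hm
    rw [Real.rpow_neg (by positivity), Real.rpow_natCast, ← one_div]
    exact hg m hm
  refine ⟨LSeries g, fun s hs => ?_, fun s hs => ?_⟩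
  · have hs' : -N < s.re := hs
    exact (analyticAt_LSeries_of_bound hg' (by linarith)).meromorphicAt
  · exact LSeriesHasSum_of_bound hg' (by linarith)

lemma inv_pow {k : ℕ} (hA : 1 - k ≤ A) :
    HasMeromorphicExtension N A fun m => ((m : ℂ) ^ k)⁻¹ := by
  refine ⟨fun s => riemannZeta (s + k), fun s _ => ?_, fun s hs => ?_⟩
  · exact (meromorphic_riemannZeta (s + k)).comp_analyticAt (g := fun s => s + (k : ℂ))
      (by fun_prop)
  · exact LSeriesHasSum_inv_pow (by simp; linarith)

lemma inv_pow_mul_log {k : ℕ} (hA : 1 - k ≤ A) :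
    HasMeromorphicExtension N A fun m => ((m : ℂ) ^ k)⁻¹ * Complex.log m := by
  refine ⟨fun s => -deriv riemannZeta (s + k), fun s _ => ?_, fun s hs => ?_⟩
  · exact ((meromorphic_riemannZeta (s + k)).deriv.comp_analyticAt (g := fun s => s + (k : ℂ))
      (by fun_prop)).neg
  · exact LSeriesHasSum_inv_pow_mul_log (by simp; linarith)

lemma shiftedPowSum_bound {x : ℝ} (hx : 0 < x) (l : ℕ) {k : ℕ} (hk : 2 ≤ k) {m : ℕ} (hm : m ≠ 0) :
    1 / (m : ℝ) ^ l * shiftedPowSum k (m * x)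
      ≤ 1 / x ^ (k - 1) * (1 / (m : ℝ) ^ (l + k - 1)) := by
  obtain ⟨p, rfl⟩ : ∃ p, k = p + 1 := ⟨k - 1, by omega⟩
  have hm' : (0 : ℝ) < m := by positivity
  calc 1 / (m : ℝ) ^ l * shiftedPowSum (p + 1) (m * x)
      ≤ 1 / (m : ℝ) ^ l * (1 / (m * x) ^ p) := by
        gcongr
        exact shiftedPowSum_le (by omega) (by positivity)
    _ = _ := by
        rw [show l + (p + 1) - 1 = l + p by omega, show p + 1 - 1 = p by omega]
        field_simp
        rw [mul_pow]
        ring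

lemma of_shiftedPowSum_bound {x : ℝ} (hx : 0 < x) {C : ℝ} {l k : ℕ} (hk : 2 ≤ k)
    (hg : ∀ m : ℕ, m ≠ 0 → ‖g m‖ ≤ C * (1 / (m : ℝ) ^ l * shiftedPowSum k (m * x)))
    (hN : N + 2 ≤ l + k) (hA : 2 - l - k ≤ A) : HasMeromorphicExtension N A g := by
  have hcast : ((l + k - 1 : ℕ) : ℝ) = l + k - 1 := by
    rw [Nat.cast_sub (by omega)]
    push_cast
    ring
  refine of_bound (C := |C| * (1 / x ^ (k - 1))) (q := l + k - 1) (fun m hm => ?_)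
    (by rw [hcast]; linarith) (by rw [hcast]; linarith)
  have hm' : (0 : ℝ) < m := by positivity
  have h0 : 0 ≤ 1 / (m : ℝ) ^ l * shiftedPowSum k (m * x) :=
    mul_nonneg (by positivity) (shiftedPowSum_nonneg k (by positivity))
  calc ‖g m‖ ≤ C * (1 / (m : ℝ) ^ l * shiftedPowSum k (m * x)) := hg m hm
    _ ≤ |C| * (1 / (m : ℝ) ^ l * shiftedPowSum k (m * x)) := by
        gcongr
        exact le_abs_self C
    _ ≤ |C| * (1 / x ^ (k - 1) * (1 / (m : ℝ) ^ (l + k - 1))) :=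
        mul_le_mul_of_nonneg_left (shiftedPowSum_bound hx l hk hm) (abs_nonneg C)
    _ = _ := by ring

/-- The bound `S_k(y) ≤ y ^ (1 - k)` alone handles `Re s > 2 - l - k`. The integer `d` bounds the
number of further unit strips to be gained. Each induction step replaces `S_{p+1}`, `p = k - 1`, by
`1 / y ^ p`, by `S_i` with `i ≥ k + 1`, which need one strip fewer, and by a remainder controlled by
`S_{p+2+d}`, which already converges far enough. -/
lemma inv_pow_mul_shiftedPowSum {x : ℝ} (hx : 0 < x) (l d k : ℕ) (hk : 2 ≤ k)
    (hN : N + 2 ≤ l + k + d) (hA : 2 - l - k ≤ A) :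
    HasMeromorphicExtension N A
      fun m => ((m : ℂ) ^ l)⁻¹ * (shiftedPowSum k (m * x) : ℂ) := by
  induction d generalizing k with
  | zero =>
    refine of_shiftedPowSum_bound (C := 1) hx (l := l) hk (fun m hm => ?_) (by simpa using hN) hA
    have : 0 ≤ shiftedPowSum k (m * x) := shiftedPowSum_nonneg k (by positivity)
    rw [norm_mul, norm_inv, norm_pow, Complex.norm_natCast, Complex.norm_real,
      Real.norm_of_nonneg this]
    simp
  | succ d ih =>
    obtain ⟨p, rfl⟩ : ∃ p, k = p + 1 := ⟨k - 1, by omega⟩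
    have hp : p ≠ 0 := by omega
    obtain ⟨c, C, hC⟩ := exists_expansion_inv_pow hp hx (M := p + 2 + d) (by omega)
    push_cast at hN hA
    set R : ℕ → ℝ := fun m => 1 / ((m : ℝ) * x) ^ p - p * shiftedPowSum (p + 1) (m * x)
        - ∑ i ∈ Finset.Ico (p + 2) (p + 2 + d), c i * shiftedPowSum i (m * x) with hR
    have h1 : HasMeromorphicExtension N A fun m => ((m : ℂ) ^ (l + p))⁻¹ :=
      inv_pow (by push_cast; linarith)
    have h2 : HasMeromorphicExtension N A (∑ i ∈ Finset.Ico (p + 2) (p + 2 + d),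
        (c i : ℂ) • fun m : ℕ => ((m : ℂ) ^ l)⁻¹ * (shiftedPowSum i (m * x) : ℂ)) := by
      refine sum fun i hi => smul _ ?_
      have hi := (Finset.mem_Ico.1 hi).1
      have hi' : (p : ℝ) + 2 ≤ i := by exact_mod_cast hi
      exact ih i (by omega) (by linarith) (by linarith)
    have h3 : HasMeromorphicExtension N A fun m => ((m : ℂ) ^ l)⁻¹ * (R m : ℂ) := by
      refine of_shiftedPowSum_bound (C := C) hx (l := l) (k := p + 2 + d) (by omega)
        (fun m hm => ?_) (by push_cast; linarith)
        (by
          have : (0 : ℝ) ≤ d := by positivity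
          push_cast; linarith)
      have := hC (m * x) (le_natCast_mul hx hm)
      rw [norm_mul, norm_inv, norm_pow, Complex.norm_natCast, Complex.norm_real, Real.norm_eq_abs,
        ← one_div, mul_left_comm]
      gcongr
    -- The expansion of `1 / y ^ p` solved for `S_{p+1}`, with `y = m x`.
    refine (((h1.smul (1 / (x : ℂ) ^ p)).add (h2.smul (-1))).add (h3.smul (-1))).smul
      (1 / (p : ℂ)) |>.congr fun m hm => ?_
    have hm' : (m : ℂ) ≠ 0 := by exact_mod_cast hm
    have hx' : (x : ℂ) ≠ 0 := by exact_mod_cast hx.ne'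
    have hp' : (p : ℂ) ≠ 0 := by exact_mod_cast hp
    simp only [Pi.smul_apply, Pi.add_apply, Finset.sum_apply, smul_eq_mul, hR]
    push_cast
    simp only [mul_sub, Finset.mul_sum, ← mul_assoc]
    have e : ∀ i, -1 * (c i : ℂ) * ((m : ℂ) ^ l)⁻¹ * (shiftedPowSum i (m * x) : ℂ)
        = -1 * ((m : ℂ) ^ l)⁻¹ * (c i : ℂ) * (shiftedPowSum i (m * x) : ℂ) := fun i => by ring
    simp only [e]
    rw [mul_pow, pow_add]
    field_simp
    ring

/-- In the expansion of `h(m x)`, the part `γ + log x + log m` contributes `ζ` and `-ζ'`, the `S_i`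
are covered by the preceding lemma, and truncation at order `2 + d` with `d ≥ N` makes the remainder
converge on the whole half-plane. -/
lemma inv_pow_mul_shiftedHarmonic {x : ℝ} (hx : 0 < x) (l : ℕ) (hA : 1 - l ≤ A) :
    HasMeromorphicExtension N A
      fun m => ((m : ℂ) ^ l)⁻¹ * (shiftedHarmonic (m * x) : ℂ) := by
  obtain ⟨d, hd⟩ := exists_nat_ge N
  obtain ⟨c, C, hC⟩ := exists_expansion_shiftedHarmonic hx (M := 2 + d) (by omega)
  set R : ℕ → ℝ := fun m => shiftedHarmonic (m * x) - Real.eulerMascheroniConstant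
      - Real.log (m * x) - ∑ i ∈ Finset.Ico 2 (2 + d), c i * shiftedPowSum i (m * x) with hR
  have hl : (0 : ℝ) ≤ l := by positivity
  have hd0 : (0 : ℝ) ≤ d := by positivity
  have h1 : HasMeromorphicExtension N A fun m => ((m : ℂ) ^ l)⁻¹ := inv_pow hA
  have h1' : HasMeromorphicExtension N A fun m => ((m : ℂ) ^ l)⁻¹ * Complex.log m :=
    inv_pow_mul_log hA
  have h2 : HasMeromorphicExtension N A (∑ i ∈ Finset.Ico 2 (2 + d),
      (c i : ℂ) • fun m : ℕ => ((m : ℂ) ^ l)⁻¹ * (shiftedPowSum i (m * x) : ℂ)) := by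
    refine sum fun i hi => smul _ ?_
    have hi := (Finset.mem_Ico.1 hi).1
    have hi' : (2 : ℝ) ≤ i := by exact_mod_cast hi
    exact inv_pow_mul_shiftedPowSum hx l d i hi (by linarith) (by linarith)
  have h3 : HasMeromorphicExtension N A fun m => ((m : ℂ) ^ l)⁻¹ * (R m : ℂ) := by
    refine of_shiftedPowSum_bound (C := C) hx (l := l) (k := 2 + d) (by omega)
      (fun m hm => ?_) (by push_cast; linarith) (by push_cast; linarith)
    have := hC (m * x) (le_natCast_mul hx hm)
    rw [norm_mul, norm_inv, norm_pow, Complex.norm_natCast, Complex.norm_real, Real.norm_eq_abs,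
      ← one_div, mul_left_comm]
    gcongr
  refine (((h1.smul ((Real.eulerMascheroniConstant : ℂ) + Real.log x)).add h1').add
    (h2.add h3)).congr fun m hm => ?_
  have hm' : (m : ℝ) ≠ 0 := by exact_mod_cast hm
  simp only [Pi.smul_apply, Pi.add_apply, Finset.sum_apply, smul_eq_mul, hR]
  rw [Real.log_mul hm' hx.ne', ← Complex.natCast_log]
  push_cast
  simp only [mul_sub, mul_add, Finset.mul_sum, ← mul_assoc]
  have e : ∀ i, (c i : ℂ) * ((m : ℂ) ^ l)⁻¹ * (shiftedPowSum i (m * x) : ℂ)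
      = ((m : ℂ) ^ l)⁻¹ * (c i : ℂ) * (shiftedPowSum i (m * x) : ℂ) := fun i => by ring
  simp only [e]
  ring

end HasMeromorphicExtension

/-! ### Gluing the extensions -/

/-- Meromorphic functions on a half-plane that agree far to the right agree near every point. -/
lemma eventuallyEq_nhdsNE_of_eq_re_gt {a A : ℝ} {F G : ℂ → ℂ}
    (hF : MeromorphicOn F {s | a < s.re}) (hG : MeromorphicOn G {s | a < s.re})
    (h : ∀ s : ℂ, A < s.re → F s = G s) {s : ℂ} (hs : a < s.re) : F =ᶠ[𝓝[≠] s] G := by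
  set z : ℂ := ((max a A + 1 : ℝ) : ℂ) with hz
  have hzre : z.re = max a A + 1 := by simp [hz]
  have hza : a < z.re := by
    have := le_max_left a A
    linarith
  have hzA : A < z.re := by
    have := le_max_right a A
    linarith
  have h1 : meromorphicOrderAt (F - G) z = ⊤ := by
    rw [meromorphicOrderAt_eq_top_iff]
    filter_upwards [mem_nhdsWithin_of_mem_nhds ((isOpen_lt_re A).mem_nhds hzA)] with w hw
    simp [h w hw]
  have h2 : meromorphicOrderAt (F - G) s = ⊤ := by
    by_contra hne
    exact (hF.sub hG).meromorphicOrderAt_ne_top_of_isPreconnected (isPreconnected_lt_re a) hs hza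
      hne h1
  rw [meromorphicOrderAt_eq_top_iff] at h2
  filter_upwards [h2] with w hw
  exact sub_eq_zero.1 hw

/-- The value at `s` is taken from an extension whose half-plane contains `s`. Near a given point
only finitely many of the extensions are used, and by the identity theorem they all agree on a
punctured neighbourhood, so the patched function is meromorphic there. -/
lemma exists_meromorphic_of_forall_hasMeromorphicExtension {A : ℝ} {g : ℕ → ℂ}
    (h : ∀ N : ℕ, HasMeromorphicExtension N A g) :
    ∃ F : ℂ → ℂ, Meromorphic F ∧ ∀ s : ℂ, A < s.re → F s = LSeries g s := by
  choose F hF hs using h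
  refine ⟨fun s => F (⌈-s.re⌉₊ + 1) s, fun s₀ => ?_, fun s hsA => (hs _ s hsA).LSeries_eq.symm⟩
  -- For `s` in the unit ball about `s₀`, the index used at `s` is at most `K`, and its half-plane
  -- also contains `s₀`.
  set K := ⌈-s₀.re + 1⌉₊ + 1 with hK
  have hmem : ∀ N : ℕ, -(N : ℝ) < s₀.re → F N =ᶠ[𝓝[≠] s₀] F K := by
    intro N hN
    have hKs : -(K : ℝ) < s₀.re := by
      have := Nat.le_ceil (-s₀.re + 1)
      rw [hK]
      push_cast
      linarith
    have hmono : ∀ M : ℕ, (min N K : ℕ) ≤ M →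
        MeromorphicOn (F M) {s | -((min N K : ℕ) : ℝ) < s.re} := fun M hM s hs' => by
      refine hF M s ?_
      have h1 : -((min N K : ℕ) : ℝ) < s.re := hs'
      have h2 : ((min N K : ℕ) : ℝ) ≤ M := by exact_mod_cast hM
      change -(M : ℝ) < s.re
      linarith
    refine eventuallyEq_nhdsNE_of_eq_re_gt (A := A) (hmono N (min_le_left _ _))
      (hmono K (min_le_right _ _))
      (fun s hsA => (hs N s hsA).LSeries_eq.symm.trans (hs K s hsA).LSeries_eq) ?_
    rcases min_choice N K with h | h <;> rw [h] <;> assumption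
  have hall : ∀ᶠ s in 𝓝[≠] s₀, ∀ N ∈ Finset.range (K + 1), -(N : ℝ) < s₀.re → F N s = F K s := by
    rw [Filter.eventually_all_finset]
    intro N _
    by_cases hN : -(N : ℝ) < s₀.re
    · filter_upwards [hmem N hN] with s hs _
      exact hs
    · exact Eventually.of_forall fun s h => absurd h hN
  have hKmero : MeromorphicAt (F K) s₀ := hF K s₀ (by
    have := Nat.le_ceil (-s₀.re + 1)
    change -(K : ℝ) < s₀.re
    rw [hK]
    push_cast
    linarith)
  refine hKmero.congr ?_
  filter_upwards [hall, mem_nhdsWithin_of_mem_nhds (Metric.ball_mem_nhds s₀ one_pos)] with s h1 h2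
  have h3 : |s.re - s₀.re| < 1 := by
    have : ‖s - s₀‖ < 1 := by simpa [dist_eq_norm] using h2
    rw [← Complex.sub_re]
    exact (Complex.abs_re_le_norm _).trans_lt this
  rw [abs_lt] at h3
  refine (h1 (⌈-s.re⌉₊ + 1) ?_ ?_).symm
  · rw [Finset.mem_range, hK]
    have : ⌈-s.re⌉₊ ≤ ⌈-s₀.re + 1⌉₊ := Nat.ceil_mono (by linarith)
    omega
  · have := Nat.le_ceil (-s.re)
    push_cast
    linarith

/-! ### Partial fractions and the coefficients of the Dirichlet series -/

/-- Partial fractions, for `A = 1 / a`, `B = 1 / b` and `w = 1 / (b - a)`. -/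
lemma pow_mul_pow_partialFraction {A B w : ℝ} (h : A * B = w * (A - B)) (r t : ℕ)
    (hrt : r + t ≠ 0) :
    A ^ r * B ^ t
      = ∑ i ∈ Finset.range r, (-1) ^ i * ((t + i - 1).choose i : ℝ) * w ^ (t + i) * A ^ (r - i)
        + (-1) ^ r * ∑ j ∈ Finset.range t,
          ((r + j - 1).choose j : ℝ) * w ^ (r + j) * B ^ (t - j) := by
  -- With truncated subtraction, `(i - 1).choose i` is `1` at `i = 0` and `0` afterwards, so when
  -- one exponent vanishes only the first term of the sum survives. Both exponents cannot vanish: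
  -- the sums would be empty while the left side is `1`.
  have base : ∀ (n : ℕ) (X : ℝ), n ≠ 0 →
      ∀ e : ℝ, ∑ i ∈ Finset.range n, e ^ i * ((i - 1).choose i : ℝ) * w ^ i * X ^ (n - i)
        = X ^ n := by
    intro n X hn e
    obtain ⟨k, rfl⟩ := Nat.exists_eq_succ_of_ne_zero hn
    rw [Nat.succ_eq_add_one, Finset.sum_range_succ', Finset.sum_eq_zero]
    · simp
    · intro i _
      rw [Nat.choose_eq_zero_of_lt (by omega)]
      simp
  induction r generalizing t with
  | zero =>
    have := base t B (by omega) 1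
    simp only [one_pow, one_mul] at this
    simp [this]
  | succ r ihr =>
    induction t with
    | zero =>
      have := base (r + 1) A (by omega) (-1)
      simp [this]
    | succ t iht =>
      -- One use of `A B = w (A - B)` lowers each exponent in turn; the binomial coefficients then
      -- recombine by Pascal's rule.
      have e1 : A ^ (r + 1) * B ^ (t + 1) = w * (A ^ (r + 1) * B ^ t - A ^ r * B ^ (t + 1)) := by
        linear_combination A ^ r * B ^ t * h
      rw [e1, iht (by omega), ihr (t + 1) (by omega)]
      have s1 : w * ∑ i ∈ Finset.range (r + 1),
            (-1) ^ i * ((t + i - 1).choose i : ℝ) * w ^ (t + i) * A ^ (r + 1 - i)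
          - w * ∑ i ∈ Finset.range r,
            (-1) ^ i * ((t + 1 + i - 1).choose i : ℝ) * w ^ (t + 1 + i) * A ^ (r - i)
          = ∑ i ∈ Finset.range (r + 1),
            (-1) ^ i * ((t + 1 + i - 1).choose i : ℝ) * w ^ (t + 1 + i) * A ^ (r + 1 - i) := by
        rw [Finset.sum_range_succ', Finset.sum_range_succ' _ r, mul_add, Finset.mul_sum,
          Finset.mul_sum, add_sub_right_comm, ← Finset.sum_sub_distrib]
        congr 1
        · refine Finset.sum_congr rfl fun i _ => ?_
          have e2 : ((t + 1 + (i + 1) - 1).choose (i + 1) : ℝ)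
              = ((t + 1 + i - 1).choose i : ℝ) + ((t + (i + 1) - 1).choose (i + 1) : ℝ) := by
            rw [show t + 1 + (i + 1) - 1 = (t + i) + 1 by omega, show t + 1 + i - 1 = t + i by omega,
              show t + (i + 1) - 1 = t + i by omega, Nat.choose_succ_succ]
            push_cast
            ring
          rw [e2, show r + 1 - (i + 1) = r - i by omega]
          ring
        · simp
          ring
      have s2 : w * ((-1) ^ (r + 1) * ∑ j ∈ Finset.range t,
            ((r + 1 + j - 1).choose j : ℝ) * w ^ (r + 1 + j) * B ^ (t - j))
          - w * ((-1) ^ r * ∑ j ∈ Finset.range (t + 1),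
            ((r + j - 1).choose j : ℝ) * w ^ (r + j) * B ^ (t + 1 - j))
          = (-1) ^ (r + 1) * ∑ j ∈ Finset.range (t + 1),
            ((r + 1 + j - 1).choose j : ℝ) * w ^ (r + 1 + j) * B ^ (t + 1 - j) := by
        rw [Finset.sum_range_succ', Finset.sum_range_succ' _ t]
        have e3 : ∑ j ∈ Finset.range t,
              ((r + 1 + (j + 1) - 1).choose (j + 1) : ℝ) * w ^ (r + 1 + (j + 1))
                * B ^ (t + 1 - (j + 1))
            = w * (∑ j ∈ Finset.range t, ((r + 1 + j - 1).choose j : ℝ) * w ^ (r + 1 + j)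
                * B ^ (t - j))
              + w * ∑ j ∈ Finset.range t, ((r + (j + 1) - 1).choose (j + 1) : ℝ)
                * w ^ (r + (j + 1)) * B ^ (t + 1 - (j + 1)) := by
          rw [Finset.mul_sum, Finset.mul_sum, ← Finset.sum_add_distrib]
          refine Finset.sum_congr rfl fun j _ => ?_
          rw [show r + 1 + (j + 1) - 1 = (r + j) + 1 by omega,
            show r + 1 + j - 1 = r + j by omega, show r + (j + 1) - 1 = r + j by omega,
            Nat.choose_succ_succ, show t + 1 - (j + 1) = t - j by omega]
          push_cast
          ring
        rw [e3]
        simp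
        ring
      rw [← s1, ← s2]
      ring

/-- The coefficient `∑_{n ≥ 1} 1 / (n ^ r * (n + m x) ^ t)` of `1 / m ^ s` in the double series. -/
def thetaCoeff (r t : ℕ) (x : ℝ) (m : ℕ) : ℝ :=
  ∑' n : ℕ, 1 / (((n : ℝ) + 1) ^ r * (m * x + n + 1) ^ t)

lemma summable_one_div_succ_pow {k : ℕ} (hk : 2 ≤ k) :
    Summable fun n : ℕ => 1 / ((n : ℝ) + 1) ^ k := by
  have := (summable_nat_add_iff 1).2 (Real.summable_one_div_nat_pow (p := k).2 (by omega))
  simpa using this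

lemma riemannZeta_natCast_eq {k : ℕ} (hk : 2 ≤ k) :
    riemannZeta k = ((∑' n : ℕ, 1 / ((n : ℝ) + 1) ^ k : ℝ) : ℂ) := by
  have h := zeta_eq_tsum_one_div_nat_add_one_cpow (s := (k : ℂ))
    (by simpa using (by omega : 1 < k))
  rw [h, Complex.ofReal_tsum]
  refine tsum_congr fun n => ?_
  push_cast
  rw [Complex.cpow_natCast]

/-- Partial fractions summed over `n` with `w = 1 / y`. The two terms of exponent one, `i = R` and
`j = T`, would diverge separately; by symmetry of the binomial coefficient they have opposite
coefficients, and together they give the convergent `shiftedHarmonic y`. -/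
lemma hasSum_thetaCoeff_succ (R T : ℕ) {y : ℝ} (hy : 0 < y) :
    HasSum (fun n : ℕ => 1 / (((n : ℝ) + 1) ^ (R + 1) * (y + n + 1) ^ (T + 1)))
      (∑ i ∈ Finset.range R, (-1) ^ i * ((T + i).choose i : ℝ) * (1 / y) ^ (T + 1 + i)
          * (∑' n : ℕ, 1 / ((n : ℝ) + 1) ^ (R + 1 - i))
        + (-1) ^ (R + 1) * ∑ j ∈ Finset.range T, ((R + j).choose j : ℝ) * (1 / y) ^ (R + 1 + j)
          * shiftedPowSum (T + 1 - j) y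
        + (-1) ^ R * ((T + R).choose R : ℝ) * (1 / y) ^ (T + R + 1) * shiftedHarmonic y) := by
  have h1 : HasSum (fun n : ℕ => ∑ i ∈ Finset.range R, (-1) ^ i * ((T + i).choose i : ℝ)
      * (1 / y) ^ (T + 1 + i) * (1 / ((n : ℝ) + 1) ^ (R + 1 - i))) _ :=
    hasSum_sum fun i hi => ((summable_one_div_succ_pow (by
      have := Finset.mem_range.1 hi
      omega)).hasSum.mul_left ((-1) ^ i * ((T + i).choose i : ℝ) * (1 / y) ^ (T + 1 + i)))
  have h2 : HasSum (fun n : ℕ => ∑ j ∈ Finset.range T, ((R + j).choose j : ℝ)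
      * (1 / y) ^ (R + 1 + j) * (1 / (y + n + 1) ^ (T + 1 - j))) _ :=
    hasSum_sum fun j hj => ((summable_shiftedPow (by
      have := Finset.mem_range.1 hj
      omega) hy).hasSum.mul_left (((R + j).choose j : ℝ) * (1 / y) ^ (R + 1 + j)))
  have h3 := (summable_shiftedHarmonic hy).hasSum.mul_left
    ((-1) ^ R * ((T + R).choose R : ℝ) * (1 / y) ^ (T + R + 1))
  refine Eq.subst (motive := fun f => HasSum f _) (funext fun n => ?_)
    ((h1.add (h2.mul_left ((-1) ^ (R + 1)))).add h3)
  have hn : (0 : ℝ) < n + 1 := by positivity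
  have hyn : 0 < y + n + 1 := by positivity
  have h := pow_mul_pow_partialFraction (A := 1 / ((n : ℝ) + 1)) (B := 1 / (y + n + 1))
    (w := 1 / y) (by field_simp; ring) (R + 1) (T + 1) (by omega)
  rw [Finset.sum_range_succ, Finset.sum_range_succ _ T] at h
  have e : 1 / (((n : ℝ) + 1) ^ (R + 1) * (y + n + 1) ^ (T + 1))
      = (1 / ((n : ℝ) + 1)) ^ (R + 1) * (1 / (y + n + 1)) ^ (T + 1) := by
    rw [one_div_pow, one_div_pow]
    field_simp
  have c1 : (T + R).choose T = (T + R).choose R := Nat.choose_symm_add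
  rw [e, h, show T + 1 + R - 1 = T + R by omega, show R + 1 + T - 1 = T + R by omega, c1,
    show R + 1 - R = 1 by omega, show T + 1 - T = 1 by omega,
    show T + 1 + R = T + R + 1 by omega, show R + 1 + T = T + R + 1 by omega]
  have c2 : ∀ i, T + 1 + i - 1 = T + i := fun i => by omega
  have c3 : ∀ i, R + 1 + i - 1 = R + i := fun i => by omega
  simp only [c2, c3, one_div_pow, pow_one]
  ring

lemma thetaCoeff_succ_eq (R T : ℕ) {x : ℝ} (hx : 0 < x) {m : ℕ} (hm : m ≠ 0) :
    (thetaCoeff (R + 1) (T + 1) x m : ℂ)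
      = ∑ i ∈ Finset.range R, ((-1) ^ i * ((T + i).choose i : ℂ) * (1 / (x : ℂ) ^ (T + 1 + i))
          * riemannZeta ((R + 1 - i : ℕ) : ℂ)) * ((m : ℂ) ^ (T + 1 + i))⁻¹
        + ∑ j ∈ Finset.range T, ((-1) ^ (R + 1) * ((R + j).choose j : ℂ)
          * (1 / (x : ℂ) ^ (R + 1 + j)))
          * (((m : ℂ) ^ (R + 1 + j))⁻¹ * (shiftedPowSum (T + 1 - j) (m * x) : ℂ))
        + ((-1) ^ R * ((T + R).choose R : ℂ) * (1 / (x : ℂ) ^ (T + R + 1)))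
          * (((m : ℂ) ^ (T + R + 1))⁻¹ * (shiftedHarmonic (m * x) : ℂ)) := by
  have hy : 0 < (m : ℝ) * x := by positivity
  rw [thetaCoeff, (hasSum_thetaCoeff_succ R T hy).tsum_eq]
  simp only [Complex.ofReal_add, Complex.ofReal_sum, Complex.ofReal_mul]
  rw [Finset.mul_sum]
  congr 1
  · congr 1
    · refine Finset.sum_congr rfl fun i hi => ?_
      rw [riemannZeta_natCast_eq (by have := Finset.mem_range.1 hi; omega)]
      push_cast
      rw [one_div_pow, mul_pow]
      field_simp
    · refine Finset.sum_congr rfl fun i hi => ?_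
      push_cast
      rw [one_div_pow, mul_pow]
      field_simp
  · push_cast
    rw [one_div_pow, mul_pow]
    field_simp

lemma hasMeromorphicExtension_thetaCoeff_succ (R T : ℕ) {x : ℝ} (hx : 0 < x) (N : ℝ) :
    HasMeromorphicExtension N (-(T : ℝ)) fun m => (thetaCoeff (R + 1) (T + 1) x m : ℂ) := by
  have hR : (0 : ℝ) ≤ R := by positivity
  have h1 : HasMeromorphicExtension N (-(T : ℝ)) (∑ i ∈ Finset.range R,
      ((-1) ^ i * ((T + i).choose i : ℂ) * (1 / (x : ℂ) ^ (T + 1 + i))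
          * riemannZeta ((R + 1 - i : ℕ) : ℂ)) • fun m : ℕ => ((m : ℂ) ^ (T + 1 + i))⁻¹) := by
    refine HasMeromorphicExtension.sum fun i _ => HasMeromorphicExtension.smul _
      (HasMeromorphicExtension.inv_pow ?_)
    have : (0 : ℝ) ≤ i := by positivity
    push_cast
    linarith
  have h2 : HasMeromorphicExtension N (-(T : ℝ)) (∑ j ∈ Finset.range T,
      ((-1) ^ (R + 1) * ((R + j).choose j : ℂ) * (1 / (x : ℂ) ^ (R + 1 + j)))
        • fun m : ℕ => (((m : ℂ) ^ (R + 1 + j))⁻¹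
          * (shiftedPowSum (T + 1 - j) (m * x) : ℂ))) := by
    refine HasMeromorphicExtension.sum fun j hj => HasMeromorphicExtension.smul _ ?_
    have hj := Finset.mem_range.1 hj
    obtain ⟨d, hd⟩ := exists_nat_ge (N + 2)
    have hc : ((T + 1 - j : ℕ) : ℝ) = T + 1 - j := by
      rw [Nat.cast_sub (by omega)]
      push_cast
      ring
    refine HasMeromorphicExtension.inv_pow_mul_shiftedPowSum hx _ d _ (by omega) ?_ ?_
    · have : (0 : ℝ) ≤ ((R + 1 + j : ℕ) : ℝ) := by positivity
      have : (0 : ℝ) ≤ ((T + 1 - j : ℕ) : ℝ) := by positivity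
      linarith
    · rw [hc]
      push_cast
      linarith
  have h3 : HasMeromorphicExtension N (-(T : ℝ))
      (((-1) ^ R * ((T + R).choose R : ℂ) * (1 / (x : ℂ) ^ (T + R + 1)))
        • fun m : ℕ => (((m : ℂ) ^ (T + R + 1))⁻¹ * (shiftedHarmonic (m * x) : ℂ))) := by
    refine HasMeromorphicExtension.smul _
      (HasMeromorphicExtension.inv_pow_mul_shiftedHarmonic hx _ ?_)
    push_cast
    linarith
  refine ((h1.add h2).add h3).congr fun m hm => ?_
  rw [thetaCoeff_succ_eq R T hx hm]
  simp only [Pi.add_apply, Finset.sum_apply, Pi.smul_apply, smul_eq_mul]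

lemma thetaCoeff_zero {r : ℕ} (hr : 2 ≤ r) (x : ℝ) (m : ℕ) :
    (thetaCoeff r 0 x m : ℂ) = riemannZeta r := by
  rw [riemannZeta_natCast_eq hr, thetaCoeff]
  simp

lemma hasMeromorphicExtension_thetaCoeff {r t : ℕ} (hr : 1 ≤ r) (hrt : 2 ≤ r + t) {x : ℝ}
    (hx : 0 < x) (N : ℝ) :
    HasMeromorphicExtension N (1 - (t : ℝ)) fun m => (thetaCoeff r t x m : ℂ) := by
  rcases t with _ | T
  · refine ((HasMeromorphicExtension.inv_pow (k := 0) (by simp)).smul (riemannZeta r)).congr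
      fun m _ => ?_
    rw [thetaCoeff_zero (by omega)]
    simp
  · obtain ⟨R, rfl⟩ : ∃ R, r = R + 1 := ⟨r - 1, by omega⟩
    have := hasMeromorphicExtension_thetaCoeff_succ R T hx N
    have e : 1 - ((T + 1 : ℕ) : ℝ) = -T := by push_cast; ring
    rwa [e]

lemma summable_thetaCoeff {r t : ℕ} (hr : 1 ≤ r) (hrt : 2 ≤ r + t) {x : ℝ} (hx : 0 < x) {m : ℕ}
    (hm : m ≠ 0) :
    Summable fun n : ℕ => 1 / (((n : ℝ) + 1) ^ r * (m * x + n + 1) ^ t) := by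
  rcases t with _ | T
  · simpa using summable_one_div_succ_pow (k := r) (by omega)
  · obtain ⟨R, rfl⟩ : ∃ R, r = R + 1 := ⟨r - 1, by omega⟩
    exact (hasSum_thetaCoeff_succ R T (by positivity)).summable

/-! ### The double series as a Dirichlet series; its continuation -/

lemma hasSum_pnat_iff_LSeriesHasSum {g : ℕ → ℂ} {s a : ℂ} :
    HasSum (fun m : ℕ+ => g m / (m : ℂ) ^ s) a ↔ LSeriesHasSum g s a := by
  rw [LSeriesHasSum, ← PNat.coe_injective.hasSum_iff]
  · refine iff_of_eq ?_
    congr 1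
    funext m
    simp [LSeries.term]
  · intro m hm
    have : m = 0 := by
      by_contra h
      exact hm ⟨⟨m, Nat.pos_of_ne_zero h⟩, rfl⟩
    simp [this]

lemma thetaTerm_natCast_eq (r t : ℕ) (s : ℂ) {x : ℝ} (m n : ℕ) :
    thetaTerm r s t x (n.succPNat, m.succPNat)
      = ((1 / (((n : ℝ) + 1) ^ r * (((m + 1 : ℕ) : ℝ) * x + n + 1) ^ t) : ℝ) : ℂ)
        / ((m + 1 : ℕ) : ℂ) ^ s := by
  have e : ((n : ℂ) + 1 + ((m : ℂ) + 1) * x) = ((m : ℂ) + 1) * x + n + 1 := by ring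
  simp only [thetaTerm, Complex.cpow_natCast, Nat.succPNat_coe, Nat.succ_eq_add_one]
  push_cast
  rw [e, div_div]
  ring

/-- For fixed `m` the norms of the terms sum over `n` to `c(m) |m ^ (-s)|`, because `c(m)` is itself
a sum of nonnegative terms. Absolute convergence of the Dirichlet series therefore gives that of the
double series, and Fubini identifies the sums. -/
lemma hasSum_thetaTerm {r t : ℕ} (hr : 1 ≤ r) (hrt : 2 ≤ r + t) {x : ℝ} (hx : 0 < x) {s : ℂ}
    (hs : 1 - (t : ℝ) < s.re) :
    Summable (thetaTerm r s t x) ∧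
      LSeriesHasSum (fun m => (thetaCoeff r t x m : ℂ)) s (thetaSeries r s t x) := by
  have hL : LSeriesSummable (fun m => (thetaCoeff r t x m : ℂ)) s := by
    obtain ⟨F, -, hF⟩ := hasMeromorphicExtension_thetaCoeff hr hrt hx 0
    exact (hF s hs).LSeriesSummable
  let e : ℕ × ℕ ≃ ℕ+ × ℕ+ := (Equiv.prodComm ℕ ℕ).trans
    (Equiv.prodCongr Equiv.pnatEquivNat.symm Equiv.pnatEquivNat.symm)
  have he : ∀ m n, thetaTerm r s t x (e (m, n))
      = ((1 / (((n : ℝ) + 1) ^ r * (((m + 1 : ℕ) : ℝ) * x + n + 1) ^ t) : ℝ) : ℂ)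
        / ((m + 1 : ℕ) : ℂ) ^ s := fun m n => thetaTerm_natCast_eq r t s m n
  have hnn : ∀ m n : ℕ,
      0 ≤ 1 / (((n : ℝ) + 1) ^ r * (((m + 1 : ℕ) : ℝ) * x + n + 1) ^ t) := by
    intro m n
    positivity
  have hnorm : ∀ m n, ‖thetaTerm r s t x (e (m, n))‖
      = 1 / (((n : ℝ) + 1) ^ r * (((m + 1 : ℕ) : ℝ) * x + n + 1) ^ t)
        * (1 / ‖((m + 1 : ℕ) : ℂ) ^ s‖) := by
    intro m n
    rw [he, norm_div, Complex.norm_real, Real.norm_of_nonneg (hnn m n)]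
    ring
  have hterm : ∀ m : ℕ, LSeries.term (fun m => (thetaCoeff r t x m : ℂ)) s (m + 1)
      = (thetaCoeff r t x (m + 1) : ℂ) / ((m + 1 : ℕ) : ℂ) ^ s := fun m =>
    LSeries.term_of_ne_zero (Nat.succ_ne_zero m) _ _
  have hsum : Summable (fun p : ℕ × ℕ => thetaTerm r s t x (e p)) := by
    refine Summable.of_norm ?_
    rw [summable_prod_of_nonneg fun p => norm_nonneg _]
    refine ⟨fun m => ?_, ?_⟩
    · simp only [hnorm]
      exact (summable_thetaCoeff hr hrt hx (Nat.succ_ne_zero m)).mul_right _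
    · simp only [hnorm, tsum_mul_right]
      refine ((summable_nat_add_iff 1).2 hL.norm).congr fun m => ?_
      rw [hterm, norm_div, Complex.norm_real, thetaCoeff,
        Real.norm_of_nonneg (tsum_nonneg fun n => hnn m n)]
      ring
  refine ⟨e.summable_iff.1 hsum, ?_⟩
  have h1 : thetaSeries r s t x = LSeries (fun m => (thetaCoeff r t x m : ℂ)) s := by
    rw [thetaSeries, ← e.tsum_eq, hsum.tsum_prod, LSeries, hL.tsum_eq_zero_add, LSeries.term_zero,
      zero_add]
    refine tsum_congr fun m => ?_
    rw [hterm, thetaCoeff, Complex.ofReal_tsum, ← tsum_div_const]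
    exact tsum_congr fun n => he m n
  rw [h1]
  exact hL.LSeriesHasSum

lemma mem_convergenceRegion_iff {r t : ℕ} (hr : 1 ≤ r) (hrt : 2 ≤ r + t) {s : ℂ} :
    (((r : ℂ), s, (t : ℂ)) : ℂ × ℂ × ℂ) ∈ convergenceRegion ↔ 1 - (t : ℝ) < s.re := by
  have h1 : (1 : ℝ) ≤ r := by exact_mod_cast hr
  have h2 : (2 : ℝ) ≤ r + t := by exact_mod_cast hrt
  simp only [convergenceRegion, Set.mem_ofPred_eq, Complex.add_re, Complex.natCast_re]
  refine ⟨fun h => by linarith [h.2.1], fun h => ⟨by linarith, by linarith, by linarith⟩⟩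

lemma exists_isThetaContinuation {r t : ℕ} (hr : 1 ≤ r) (hrt : 2 ≤ r + t) {x : ℝ} (hx : 0 < x) :
    ∃ F : ℂ → ℂ, IsThetaContinuation r t x F := by
  obtain ⟨F, hF, hs⟩ := exists_meromorphic_of_forall_hasMeromorphicExtension
    fun N : ℕ => hasMeromorphicExtension_thetaCoeff hr hrt hx N
  refine ⟨F, hF, fun s h => ?_⟩
  have h' := (mem_convergenceRegion_iff hr hrt).1 h
  rw [hs s h', (hasSum_thetaTerm hr hrt hx h').2.LSeries_eq]

/-- Near `1 - t`, a continuation of the double series is determined by the series. -/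
lemma IsThetaContinuation.eventuallyEq {r t : ℕ} (hr : 1 ≤ r) (hrt : 2 ≤ r + t) {x : ℝ}
    {F G : ℂ → ℂ} (hF : IsThetaContinuation r t x F) (hG : MeromorphicAt G (1 - (t : ℂ)))
    (h : ∀ s : ℂ, 1 - (t : ℝ) < s.re → G s = thetaSeries r s t x) :
    F =ᶠ[𝓝[≠] (1 - (t : ℂ))] G := by
  -- Meromorphic functions that agree at points accumulating at `1 - t` agree on a punctured
  -- neighbourhood. That point lies on the boundary of the half-plane of convergence, so `1 - t + 1
  -- / (n + 1)` serves.
  rw [← (hF.meromorphic _).frequently_eq_iff_eventuallyEq hG]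
  have ht : Tendsto (fun n : ℕ => (1 - (t : ℂ)) + ((1 / ((n : ℝ) + 1) : ℝ) : ℂ)) atTop
      (𝓝[≠] (1 - (t : ℂ))) := by
    refine tendsto_nhdsWithin_iff.2 ⟨?_, ?_⟩
    · have := (Complex.continuous_ofReal.tendsto 0).comp tendsto_one_div_add_atTop_nhds_zero_nat
      simpa [Function.comp_def] using this.const_add (1 - (t : ℂ))
    · refine Eventually.of_forall fun n => ?_
      have : (((1 / ((n : ℝ) + 1) : ℝ)) : ℂ) ≠ 0 := by
        have : 0 < 1 / ((n : ℝ) + 1) := by positivity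
        exact_mod_cast this.ne'
      simpa using this
  refine ht.frequently (Frequently.of_forall fun n => ?_)
  have hre : 1 - (t : ℝ) < ((1 - (t : ℂ)) + ((1 / ((n : ℝ) + 1) : ℝ) : ℂ)).re := by
    have : 0 < 1 / ((n : ℝ) + 1) := by positivity
    simp only [Complex.add_re, Complex.sub_re, Complex.one_re, Complex.natCast_re,
      Complex.ofReal_re]
    linarith
  rw [h _ hre, hF.eq_series _ ((mem_convergenceRegion_iff hr hrt).2 hre)]

/-! ### Laurent expansions and pole orders -/

lemma stieltjesOne_eq : stieltjesOne = -deriv zetaRegular 1 := by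
  refine Tendsto.limUnder_eq ?_
  have h := (analyticAt_zetaRegular_one.differentiableAt.hasDerivAt.tendsto_slope).neg
  refine h.congr' ?_
  filter_upwards [self_mem_nhdsWithin] with s hs
  have hs1 : s ≠ 1 := hs
  have hs2 : s - 1 ≠ 0 := sub_ne_zero.2 hs1
  rw [slope_def_field, zetaRegular_one, riemannZeta_eq_add_zetaRegular hs1]
  ring

lemma deriv_riemannZeta_eq_add {s : ℂ} (hs : s ≠ 1)
    (hd : DifferentiableAt ℂ zetaRegular s) :
    deriv riemannZeta s = -(1 / (s - 1) ^ 2) + deriv zetaRegular s := by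
  have hs2 : s - 1 ≠ 0 := sub_ne_zero.2 hs
  have h1 : riemannZeta =ᶠ[𝓝 s] fun s => 1 / (s - 1) + zetaRegular s := by
    filter_upwards [isOpen_ne.mem_nhds hs] with w hw
    exact riemannZeta_eq_add_zetaRegular hw
  have h2 : HasDerivAt (fun s : ℂ => (s - 1)⁻¹) (-1 / (s - 1) ^ 2) s :=
    ((hasDerivAt_id s).sub_const 1).fun_inv hs2
  have h3 := h2.fun_add hd.hasDerivAt
  rw [h1.deriv_eq]
  simp only [one_div]
  rw [h3.deriv]
  ring

/-- A nonzero limit means that `(s - p) ^ k * F` has order `0`, and orders add under multiplication.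
-/
lemma meromorphicOrderAt_eq_neg_of_tendsto {F : ℂ → ℂ} {p c : ℂ} (k : ℕ)
    (hF : MeromorphicAt F p) (hc : c ≠ 0)
    (h : Tendsto (fun s => (s - p) ^ k * F s) (𝓝[≠] p) (𝓝 c)) :
    meromorphicOrderAt F p = ((-(k : ℤ) : ℤ) : WithTop ℤ) := by
  have hsub : MeromorphicAt (fun s : ℂ => (s - p) ^ k) p := by fun_prop
  have h0 := (tendsto_ne_zero_iff_meromorphicOrderAt_eq_zero (hsub.mul hF)).1 ⟨c, hc, h⟩
  have h1 : meromorphicOrderAt (fun s : ℂ => (s - p) ^ k) p = ((k : ℤ) : WithTop ℤ) := by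
    rw [meromorphicOrderAt_eq_int_iff hsub]
    exact ⟨fun _ => 1, analyticAt_const, one_ne_zero, Eventually.of_forall fun s => by simp⟩
  rw [meromorphicOrderAt_mul hsub hF, h1] at h0
  cases hF' : meromorphicOrderAt F p with
  | top => simp [hF'] at h0
  | coe n =>
    rw [hF'] at h0
    have h2 : (k : ℤ) + n = 0 := by exact_mod_cast h0
    congr 1
    omega

lemma tendsto_sub_nhdsNE (p : ℂ) : Tendsto (fun s => s - p) (𝓝[≠] p) (𝓝 0) := by
  have : Tendsto (fun s : ℂ => s - p) (𝓝 p) (𝓝 (p - p)) := tendsto_id.sub_const p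
  rw [sub_self] at this
  exact this.mono_left nhdsWithin_le_nhds

lemma isBigO_sub_laurent {F H : ℂ → ℂ} {p a₁ a₂ K : ℂ} (hH : DifferentiableAt ℂ H p)
    (h : F =ᶠ[𝓝[≠] p] fun s => a₂ / (s - p) ^ 2 + a₁ / (s - p) + H s) (hK : K = H p) :
    (fun s => F s - (a₂ / (s - p) ^ 2 + a₁ / (s - p) + K)) =O[𝓝[≠] p] fun s => s - p := by
  refine (hH.isBigO_sub.mono nhdsWithin_le_nhds).congr' ?_ EventuallyEq.rfl
  filter_upwards [h] with s hs
  rw [hs, hK]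
  ring

lemma tendsto_sq_mul_of_laurent {F H : ℂ → ℂ} {p a₁ a₂ : ℂ} (hH : DifferentiableAt ℂ H p)
    (h : F =ᶠ[𝓝[≠] p] fun s => a₂ / (s - p) ^ 2 + a₁ / (s - p) + H s) :
    Tendsto (fun s => (s - p) ^ 2 * F s) (𝓝[≠] p) (𝓝 a₂) := by
  have h0 := tendsto_sub_nhdsNE p
  have h1 := (tendsto_const_nhds (x := a₂)).add ((h0.const_mul a₁).add
    ((h0.pow 2).mul (hH.continuousAt.tendsto.mono_left nhdsWithin_le_nhds)))
  have e : a₂ + (a₁ * 0 + 0 ^ 2 * H p) = a₂ := by ring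
  rw [e] at h1
  refine h1.congr' ?_
  filter_upwards [h, self_mem_nhdsWithin] with s hs hsp
  have : s - p ≠ 0 := sub_ne_zero.2 hsp
  rw [hs]
  field_simp
  ring

lemma tendsto_mul_of_laurent {F H : ℂ → ℂ} {p a₁ : ℂ} (hH : DifferentiableAt ℂ H p)
    (h : F =ᶠ[𝓝[≠] p] fun s => a₁ / (s - p) + H s) :
    Tendsto (fun s => (s - p) ^ 1 * F s) (𝓝[≠] p) (𝓝 a₁) := by
  have h0 := tendsto_sub_nhdsNE p
  have h1 := (tendsto_const_nhds (x := a₁)).add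
    (h0.mul (hH.continuousAt.tendsto.mono_left nhdsWithin_le_nhds))
  have e : a₁ + 0 * H p = a₁ := by ring
  rw [e] at h1
  refine h1.congr' ?_
  filter_upwards [h, self_mem_nhdsWithin] with s hs hsp
  have : s - p ≠ 0 := sub_ne_zero.2 hsp
  rw [hs]
  field_simp

lemma eventually_add_natCast_ne_one (t : ℕ) :
    ∀ᶠ s : ℂ in 𝓝[≠] (1 - (t : ℂ)), s + t ≠ 1 := by
  filter_upwards [self_mem_nhdsWithin] with s hs h
  exact hs (by rw [← h]; simp)

lemma analyticAt_zetaRegular_add (t : ℕ) :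
    AnalyticAt ℂ (fun s : ℂ => zetaRegular (s + t)) (1 - (t : ℂ)) := by
  refine AnalyticAt.fun_comp (g := zetaRegular) (f := fun s : ℂ => s + t) ?_ (by fun_prop)
  simpa using analyticAt_zetaRegular_one

/-- Simple pole coming from `ζ (s + t)`. -/
lemma simplePole_of_riemannZeta {F H₀ : ℂ → ℂ} {t : ℕ} {a K : ℂ} (ha : a ≠ 0)
    (hF : MeromorphicAt F (1 - (t : ℂ))) (hH : AnalyticAt ℂ H₀ (1 - (t : ℂ)))
    (h : F =ᶠ[𝓝[≠] (1 - (t : ℂ))] fun s => a * riemannZeta (s + t) + H₀ s)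
    (hK : K = a * (Real.eulerMascheroniConstant : ℂ) + H₀ (1 - (t : ℂ))) :
    meromorphicOrderAt F (1 - (t : ℂ)) = ((-1 : ℤ) : WithTop ℤ) ∧
      (fun s : ℂ => F s - (a / (s - (1 - (t : ℂ))) + K)) =O[𝓝[≠] (1 - (t : ℂ))]
        fun s : ℂ => s - (1 - (t : ℂ)) := by
  have hd : DifferentiableAt ℂ (fun s => a * zetaRegular (s + t) + H₀ s) (1 - (t : ℂ)) :=
    ((analyticAt_zetaRegular_add t).differentiableAt.const_mul a).add hH.differentiableAt
  have h' : F =ᶠ[𝓝[≠] (1 - (t : ℂ))] fun s => a / (s - (1 - (t : ℂ)))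
      + (a * zetaRegular (s + t) + H₀ s) := by
    filter_upwards [h, eventually_add_natCast_ne_one t] with s hs hne
    rw [hs, riemannZeta_eq_add_zetaRegular hne, show s + t - 1 = s - (1 - (t : ℂ)) by ring]
    ring
  refine ⟨meromorphicOrderAt_eq_neg_of_tendsto 1 hF ha (tendsto_mul_of_laurent hd h'), ?_⟩
  have h2 := isBigO_sub_laurent (a₂ := 0) (a₁ := a) (K := K) hd
    (h'.trans (Eventually.of_forall fun s => by simp)) (by simp [hK, zetaRegular_one])
  simpa using h2

/-- Double pole coming from `-ζ' (s + t)` and `ζ (s + t)`. -/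
lemma doublePole_of_riemannZeta {F H₀ : ℂ → ℂ} {t : ℕ} {a b K : ℂ} (ha : a ≠ 0)
    (hF : MeromorphicAt F (1 - (t : ℂ))) (hH : AnalyticAt ℂ H₀ (1 - (t : ℂ)))
    (h : F =ᶠ[𝓝[≠] (1 - (t : ℂ))]
      fun s => a * -deriv riemannZeta (s + t) + a * b * riemannZeta (s + t) + H₀ s)
    (hK : K = a * (Real.eulerMascheroniConstant * b + stieltjesOne) + H₀ (1 - (t : ℂ))) :
    meromorphicOrderAt F (1 - (t : ℂ)) = ((-2 : ℤ) : WithTop ℤ) ∧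
      (fun s : ℂ => F s - (a / (s - (1 - (t : ℂ))) ^ 2 + a / (s - (1 - (t : ℂ))) * b + K))
        =O[𝓝[≠] (1 - (t : ℂ))] fun s : ℂ => s - (1 - (t : ℂ)) := by
  have hder : AnalyticAt ℂ (fun s : ℂ => deriv zetaRegular (s + t)) (1 - (t : ℂ)) := by
    refine AnalyticAt.fun_comp (g := deriv zetaRegular) (f := fun s : ℂ => s + t) ?_ (by fun_prop)
    simpa using analyticAt_zetaRegular_one.deriv
  have hd : DifferentiableAt ℂ (fun s => a * -deriv zetaRegular (s + t)
      + a * b * zetaRegular (s + t) + H₀ s) (1 - (t : ℂ)) :=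
    ((hder.differentiableAt.neg.const_mul a).add
      ((analyticAt_zetaRegular_add t).differentiableAt.const_mul (a * b))).add hH.differentiableAt
  have hreg : ∀ᶠ s : ℂ in 𝓝[≠] (1 - (t : ℂ)), DifferentiableAt ℂ zetaRegular (s + t) := by
    have h1 := analyticAt_zetaRegular_one.eventually_analyticAt
    have h2 : Tendsto (fun s : ℂ => s + t) (𝓝 (1 - (t : ℂ))) (𝓝 1) := by
      have : Tendsto (fun s : ℂ => s + t) (𝓝 (1 - (t : ℂ))) (𝓝 (1 - (t : ℂ) + t)) :=
        tendsto_id.add_const _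
      simpa using this
    exact ((h2.eventually h1).mono fun s hs => hs.differentiableAt).filter_mono nhdsWithin_le_nhds
  have h' : F =ᶠ[𝓝[≠] (1 - (t : ℂ))] fun s => a / (s - (1 - (t : ℂ))) ^ 2
      + (a * b) / (s - (1 - (t : ℂ)))
      + (a * -deriv zetaRegular (s + t) + a * b * zetaRegular (s + t) + H₀ s) := by
    filter_upwards [h, eventually_add_natCast_ne_one t, hreg] with s hs hne hr
    rw [hs, riemannZeta_eq_add_zetaRegular hne, deriv_riemannZeta_eq_add hne hr,
      show s + t - 1 = s - (1 - (t : ℂ)) by ring]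
    ring
  refine ⟨meromorphicOrderAt_eq_neg_of_tendsto 2 hF ha (tendsto_sq_mul_of_laurent hd h'), ?_⟩
  have h2 := isBigO_sub_laurent (K := K) hd h' (by
    simp only [hK, sub_add_cancel, zetaRegular_one, stieltjesOne_eq]
    ring)
  refine h2.congr_left fun s => ?_
  ring

/-! ### Growth bounds and half-planes of analyticity -/

lemma exists_bound_natCast_mul {φ : ℝ → ℝ} {x C : ℝ} (hx : 0 < x) {k : ℕ}
    (h : ∀ y, x ≤ y → |φ y| ≤ C * (1 / y ^ k)) :
    ∃ C', ∀ m : ℕ, m ≠ 0 → ‖(φ (m * x) : ℂ)‖ ≤ C' * (m : ℝ) ^ (-(k : ℝ)) := by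
  refine ⟨C * (1 / x ^ k), fun m hm => ?_⟩
  have hm' : (0 : ℝ) < m := by positivity
  have h1 := h (m * x) (le_natCast_mul hx hm)
  rw [Complex.norm_real, Real.norm_eq_abs, Real.rpow_neg hm'.le, Real.rpow_natCast]
  refine h1.trans (le_of_eq ?_)
  rw [mul_pow]
  field_simp

lemma exists_bound_shiftedPowSum {x : ℝ} (hx : 0 < x) {k : ℕ} (hk : 2 ≤ k) :
    ∃ C, ∀ m : ℕ, m ≠ 0 →
      ‖(shiftedPowSum k (m * x) : ℂ)‖ ≤ C * (m : ℝ) ^ (-((k - 1 : ℕ) : ℝ)) := by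
  refine exists_bound_natCast_mul (C := 1) hx fun y hy => ?_
  have hy0 : 0 < y := hx.trans_le hy
  obtain ⟨p, rfl⟩ : ∃ p, k = p + 1 := ⟨k - 1, by omega⟩
  rw [abs_of_nonneg (shiftedPowSum_nonneg _ hy0), one_mul]
  exact shiftedPowSum_le (by omega) hy0

lemma abs_shiftedHarmonic_sub_le {x : ℝ} (hx : 0 < x) :
    ∃ C, 0 ≤ C ∧ ∀ y, x ≤ y →
      |shiftedHarmonic y - Real.eulerMascheroniConstant - Real.log y| ≤ C * (1 / y) := by
  obtain ⟨c, C, hC⟩ := exists_expansion_shiftedHarmonic hx (M := 2) le_rfl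
  refine ⟨|C|, abs_nonneg C, fun y hy => ?_⟩
  have hy0 : 0 < y := hx.trans_le hy
  have h := hC y hy
  rw [Finset.Ico_self, Finset.sum_empty, sub_zero] at h
  have h1 := shiftedPowSum_le (p := 1) one_ne_zero hy0
  rw [pow_one] at h1
  calc _ ≤ C * shiftedPowSum 2 y := h
    _ ≤ |C| * shiftedPowSum 2 y :=
        mul_le_mul_of_nonneg_right (le_abs_self C) (shiftedPowSum_nonneg 2 hy0)
    _ ≤ |C| * (1 / y) := mul_le_mul_of_nonneg_left h1 (abs_nonneg C)

/-- The growth is logarithmic. The exponent `1 / 2` is a convenient majorant: any exponent below `1`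
suffices, as the series is evaluated only near integers `≥ 2`. -/
lemma exists_bound_shiftedHarmonic {x : ℝ} (hx : 0 < x) :
    ∃ C, ∀ m : ℕ, m ≠ 0 → ‖(shiftedHarmonic (m * x) : ℂ)‖ ≤ C * (m : ℝ) ^ (1 / 2 : ℝ) := by
  obtain ⟨C, hC0, hC⟩ := abs_shiftedHarmonic_sub_le hx
  refine ⟨C * (1 / x) + |Real.eulerMascheroniConstant| + |Real.log x| + 2, fun m hm => ?_⟩
  have hm1 : (1 : ℝ) ≤ m := by exact_mod_cast Nat.one_le_iff_ne_zero.2 hm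
  have hle := le_natCast_mul hx hm
  have h := hC (m * x) hle
  have h1 : (1 : ℝ) ≤ (m : ℝ) ^ (1 / 2 : ℝ) := Real.one_le_rpow hm1 (by norm_num)
  have h2 : Real.log m ≤ 2 * (m : ℝ) ^ (1 / 2 : ℝ) := by
    have := Real.log_le_rpow_div (x := m) (by positivity) (ε := 1 / 2) (by norm_num)
    linarith
  have h3 : C * (1 / (m * x)) ≤ C * (1 / x) := by gcongr
  have h4 : 0 ≤ Real.log m := Real.log_nonneg hm1
  rw [Real.log_mul (by positivity) hx.ne'] at h
  rw [Complex.norm_real, Real.norm_eq_abs]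
  have h5 : |shiftedHarmonic (m * x)| ≤ C * (1 / x) + |Real.eulerMascheroniConstant|
      + |Real.log x| + Real.log m := by
    have a1 := abs_le.1 (h.trans h3)
    have a2 := neg_abs_le Real.eulerMascheroniConstant
    have a3 := le_abs_self Real.eulerMascheroniConstant
    have a4 := neg_abs_le (Real.log x)
    have a5 := le_abs_self (Real.log x)
    rw [abs_le]
    constructor <;> linarith [a1.1, a1.2]
  have h6 : 0 ≤ C * (1 / x) + |Real.eulerMascheroniConstant| + |Real.log x| := by positivity
  nlinarith

/-- `shiftedPowSum k y + 1 / y ^ k` without its leading term. -/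
def powSumRemainder (k : ℕ) (y : ℝ) : ℝ :=
  shiftedPowSum k y + 1 / y ^ k - 1 / ((k - 1 : ℕ) * y ^ (k - 1))

/-- `ψ y - log y` for `y > 0`. -/
def digammaRemainder (y : ℝ) : ℝ :=
  shiftedHarmonic y - Real.eulerMascheroniConstant - 1 / y - Real.log y

/-- The shortest expansion, `M = p + 2`, bounds `1 / y ^ p - p S_{p+1}(y)` by a multiple of `y ^
(-p-1)`. Removing the leading term thus gains one power of `y`, and the Dirichlet series then
converges at `2 - k`, the edge point for `S_k`. -/
lemma exists_bound_powSumRemainder {x : ℝ} (hx : 0 < x) {k : ℕ} (hk : 2 ≤ k) :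
    ∃ C, ∀ m : ℕ, m ≠ 0 → ‖(powSumRemainder k (m * x) : ℂ)‖ ≤ C * (m : ℝ) ^ (-(k : ℝ)) := by
  obtain ⟨p, rfl⟩ : ∃ p, k = p + 1 := ⟨k - 1, by omega⟩
  have hp : p ≠ 0 := by omega
  obtain ⟨c, C, hC⟩ := exists_expansion_inv_pow hp hx (M := p + 2) le_rfl
  refine exists_bound_natCast_mul (C := |C| + 1) hx fun y hy => ?_
  have hy0 : 0 < y := hx.trans_le hy
  have h := hC y hy
  rw [Finset.Ico_self, Finset.sum_empty, sub_zero] at h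
  have hp1 : (1 : ℝ) ≤ p := by exact_mod_cast Nat.one_le_iff_ne_zero.2 hp
  have h1 : |1 / y ^ p - p * shiftedPowSum (p + 1) y| ≤ |C| * (1 / y ^ (p + 1)) := by
    calc _ ≤ C * shiftedPowSum (p + 2) y := h
      _ ≤ |C| * shiftedPowSum (p + 2) y :=
          mul_le_mul_of_nonneg_right (le_abs_self C) (shiftedPowSum_nonneg _ hy0)
      _ ≤ |C| * (1 / y ^ (p + 1)) :=
          mul_le_mul_of_nonneg_left (shiftedPowSum_le (by omega) hy0) (abs_nonneg C)
  have e : powSumRemainder (p + 1) y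
      = -(1 / p) * (1 / y ^ p - p * shiftedPowSum (p + 1) y) + 1 / y ^ (p + 1) := by
    rw [powSumRemainder, Nat.add_sub_cancel]
    field_simp
    ring
  have h2 : |-(1 / (p : ℝ))| ≤ 1 := by
    rw [abs_neg, abs_of_nonneg (by positivity), div_le_one (by positivity)]
    exact hp1
  calc |powSumRemainder (p + 1) y|
      ≤ |-(1 / (p : ℝ)) * (1 / y ^ p - p * shiftedPowSum (p + 1) y)| + |1 / y ^ (p + 1)| := by
        rw [e]
        exact abs_add_le _ _
    _ ≤ 1 * (|C| * (1 / y ^ (p + 1))) + 1 / y ^ (p + 1) := by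
        rw [abs_mul, abs_of_nonneg (a := 1 / y ^ (p + 1)) (by positivity)]
        gcongr
    _ = _ := by ring

lemma exists_bound_digammaRemainder {x : ℝ} (hx : 0 < x) :
    ∃ C, ∀ m : ℕ, m ≠ 0 →
      ‖(digammaRemainder (m * x) : ℂ)‖ ≤ C * (m : ℝ) ^ (-((1 : ℕ) : ℝ)) := by
  obtain ⟨C, hC0, hC⟩ := abs_shiftedHarmonic_sub_le hx
  refine exists_bound_natCast_mul (C := C + 1) hx fun y hy => ?_
  have hy0 : 0 < y := hx.trans_le hy
  have h := abs_le.1 (hC y hy)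
  have h1 : 0 < 1 / y := by positivity
  rw [digammaRemainder, pow_one, abs_le]
  constructor <;> linarith [h.1, h.2]

lemma digamma_ofReal_sub_log {y : ℝ} (hy : 0 < y) :
    Complex.digamma (y : ℂ) - (Real.log y : ℂ) = (digammaRemainder y : ℂ) := by
  have h1 := digamma_add_one_ofReal hy
  rw [digamma_add_one_eq hy] at h1
  rw [digammaRemainder]
  push_cast
  linear_combination -h1

/-- A multiple of a Dirichlet series at an integer, as a sum over the positive integers. -/
lemma hasSum_pnat_of_LSeriesHasSum {g : ℕ → ℂ} {e : ℤ} {a : ℂ} (hg : LSeriesHasSum g (e : ℂ) a)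
    (c : ℂ) {G : ℕ+ → ℂ} (h : ∀ m : ℕ+, G m = c * g m / (m : ℂ) ^ e) : HasSum G (c * a) := by
  have h1 := (hasSum_pnat_iff_LSeriesHasSum.2 hg).mul_left c
  refine Eq.subst (motive := fun f => HasSum f _) (funext fun m => ?_) h1
  rw [h m, Complex.cpow_intCast]
  ring

section DirichletSeries

variable {x : ℝ} {s : ℂ}

lemma analyticAt_LSeries_shiftedPowSum (hx : 0 < x) {k : ℕ} (hk : 2 ≤ k)
    (hs : 2 - (k : ℝ) < s.re) :
    AnalyticAt ℂ (LSeries fun m => (shiftedPowSum k (m * x) : ℂ)) s ∧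
      LSeriesHasSum (fun m => (shiftedPowSum k (m * x) : ℂ)) s
        (LSeries (fun m => (shiftedPowSum k (m * x) : ℂ)) s) := by
  obtain ⟨C, hC⟩ := exists_bound_shiftedPowSum hx hk
  have h : -((k - 1 : ℕ) : ℝ) + 1 < s.re := by
    rw [Nat.cast_sub (by omega)]
    push_cast
    linarith
  exact ⟨analyticAt_LSeries_of_bound hC h, LSeriesHasSum_of_bound hC h⟩

lemma analyticAt_LSeries_shiftedHarmonic (hx : 0 < x) (hs : 3 / 2 < s.re) :
    AnalyticAt ℂ (LSeries fun m => (shiftedHarmonic (m * x) : ℂ)) s ∧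
      LSeriesHasSum (fun m => (shiftedHarmonic (m * x) : ℂ)) s
        (LSeries (fun m => (shiftedHarmonic (m * x) : ℂ)) s) := by
  obtain ⟨C, hC⟩ := exists_bound_shiftedHarmonic hx
  exact ⟨analyticAt_LSeries_of_bound hC (by linarith), LSeriesHasSum_of_bound hC (by linarith)⟩

lemma analyticAt_LSeries_powSumRemainder (hx : 0 < x) {k : ℕ} (hk : 2 ≤ k)
    (hs : 1 - (k : ℝ) < s.re) :
    AnalyticAt ℂ (LSeries fun m => (powSumRemainder k (m * x) : ℂ)) s ∧
      LSeriesHasSum (fun m => (powSumRemainder k (m * x) : ℂ)) s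
        (LSeries (fun m => (powSumRemainder k (m * x) : ℂ)) s) := by
  obtain ⟨C, hC⟩ := exists_bound_powSumRemainder hx hk
  exact ⟨analyticAt_LSeries_of_bound hC (by linarith), LSeriesHasSum_of_bound hC (by linarith)⟩

lemma analyticAt_LSeries_digammaRemainder (hx : 0 < x) (hs : 0 < s.re) :
    AnalyticAt ℂ (LSeries fun m => (digammaRemainder (m * x) : ℂ)) s ∧
      LSeriesHasSum (fun m => (digammaRemainder (m * x) : ℂ)) s
        (LSeries (fun m => (digammaRemainder (m * x) : ℂ)) s) := by
  obtain ⟨C, hC⟩ := exists_bound_digammaRemainder hx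
  exact ⟨analyticAt_LSeries_of_bound hC (by push_cast; linarith),
    LSeriesHasSum_of_bound hC (by push_cast; linarith)⟩

end DirichletSeries

/-! ### The polygamma sums as values of Dirichlet series -/

section PolygammaSums

variable {x : ℝ}

/-- The series of `S_{t-j}(m x)` converges to the right of `2 - (t - j)`, and `r ≥ 2` puts the
exponent strictly inside. -/
lemma hasSum_polygamma_add_one (hx : 0 < x) {r t j : ℕ} (hr : 2 ≤ r)
    (hj : j ∈ Finset.range (t - 1)) :
    HasSum (fun m : ℕ+ =>
        polygamma (t - j - 1) ((m : ℂ) * x + 1) / (m : ℂ) ^ ((r : ℤ) + j - t + 1))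
      ((-1) ^ (t - j) * ((t - j - 1).factorial : ℂ)
        * LSeries (fun m => (shiftedPowSum (t - j) (m * x) : ℂ))
          (((r : ℤ) + j - t + 1 : ℤ) : ℂ)) := by
  have hj := Finset.mem_range.1 hj
  obtain ⟨k, hk⟩ : ∃ k, t - j = k + 2 := ⟨t - j - 2, by omega⟩
  have ht : (t : ℝ) = k + 2 + j := by
    have : t = k + 2 + j := by omega
    exact_mod_cast this
  have hr' : (2 : ℝ) ≤ r := by exact_mod_cast hr
  rw [hk, show k + 2 - 1 = k + 1 by omega]
  refine hasSum_pnat_of_LSeriesHasSum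
    (analyticAt_LSeries_shiftedPowSum hx (by omega) ?_).2 _ fun m => ?_
  · rw [Complex.intCast_re]
    push_cast
    linarith
  · have hm : (0 : ℝ) < (m : ℕ) := by exact_mod_cast m.pos
    have h := polygamma_add_one_ofReal k (y := (m : ℕ) * x) (by positivity)
    push_cast at h
    rw [h, pow_add (-1 : ℂ) k 2]
    norm_num

lemma hasSum_eulerMascheroni_add_digamma (hx : 0 < x) {r : ℕ} (hr : 2 ≤ r) :
    HasSum (fun m : ℕ+ =>
        ((Real.eulerMascheroniConstant : ℂ) + Complex.digamma ((m : ℂ) * x + 1)) / (m : ℂ) ^ r)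
      (LSeries (fun m => (shiftedHarmonic (m * x) : ℂ)) r) := by
  have hr' : (2 : ℝ) ≤ r := by exact_mod_cast hr
  have h0 := (analyticAt_LSeries_shiftedHarmonic (s := ((r : ℤ) : ℂ)) hx (by
    rw [Complex.intCast_re]
    push_cast
    linarith)).2
  have h1 := hasSum_pnat_of_LSeriesHasSum h0 1
    (G := fun m : ℕ+ => ((Real.eulerMascheroniConstant : ℂ)
      + Complex.digamma ((m : ℂ) * x + 1)) / (m : ℂ) ^ r) fun m => by
    have hm : (0 : ℝ) < (m : ℕ) := by exact_mod_cast m.pos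
    have h := digamma_add_one_eq (y := (m : ℕ) * x) (by positivity)
    push_cast at h
    rw [h, zpow_natCast]
    ring
  simpa using h1

/-- The exponent is now exactly `2 - (t - j)`, on the edge. The subtracted term is the leading term
of the polygamma function, so what remains is a multiple of `powSumRemainder`; the argument `m x`
instead of `m x + 1` accounts for its summand `1 / y ^ k`. -/
lemma hasSum_polygamma_sub (hx : 0 < x) {t j : ℕ} (hj : j ∈ Finset.range (t - 1)) :
    HasSum (fun m : ℕ+ =>
        (polygamma (t - j - 1) ((m : ℂ) * x)
            - (-1) ^ (t - j) * ((t - j - 2).factorial : ℂ) / ((m : ℂ) * x) ^ (t - j - 1))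
          / (m : ℂ) ^ ((j : ℤ) - t + 2))
      ((-1) ^ (t - j) * ((t - j - 1).factorial : ℂ)
        * LSeries (fun m => (powSumRemainder (t - j) (m * x) : ℂ))
          (((j : ℤ) - t + 2 : ℤ) : ℂ)) := by
  have hj := Finset.mem_range.1 hj
  obtain ⟨k, hk⟩ : ∃ k, t - j = k + 2 := ⟨t - j - 2, by omega⟩
  have ht : (t : ℝ) = k + 2 + j := by
    have : t = k + 2 + j := by omega
    exact_mod_cast this
  rw [hk, show k + 2 - 1 = k + 1 by omega, show k + 2 - 2 = k by omega]
  refine hasSum_pnat_of_LSeriesHasSum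
    (analyticAt_LSeries_powSumRemainder hx (by omega) ?_).2 _ fun m => ?_
  · rw [Complex.intCast_re]
    push_cast
    linarith
  · have hm : (0 : ℝ) < (m : ℕ) := by exact_mod_cast m.pos
    have hm' : ((m : ℕ) : ℂ) ≠ 0 := by exact_mod_cast hm.ne'
    have hx' : (x : ℂ) ≠ 0 := by exact_mod_cast hx.ne'
    have hk' : (k : ℂ) + 1 ≠ 0 := by exact_mod_cast Nat.succ_ne_zero k
    have h := polygamma_ofReal k (y := (m : ℕ) * x) (by positivity)
    push_cast at h
    rw [h, pow_add (-1 : ℂ) k 2, powSumRemainder, show k + 2 - 1 = k + 1 by omega,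
      Nat.factorial_succ]
    push_cast
    congr 1
    field_simp
    ring

lemma hasSum_digamma_sub_log (hx : 0 < x) :
    HasSum (fun m : ℕ+ =>
        (Complex.digamma ((m : ℂ) * x) - (Real.log ((m : ℝ) * x) : ℂ)) / (m : ℂ))
      (LSeries (fun m => (digammaRemainder (m * x) : ℂ)) 1) := by
  have h0 := (analyticAt_LSeries_digammaRemainder (s := ((1 : ℤ) : ℂ)) hx (by simp)).2
  have h1 := hasSum_pnat_of_LSeriesHasSum h0 1
    (G := fun m : ℕ+ =>
      (Complex.digamma ((m : ℂ) * x) - (Real.log ((m : ℝ) * x) : ℂ)) / (m : ℂ)) fun m => by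
    have hm : (0 : ℝ) < (m : ℕ) := by exact_mod_cast m.pos
    have h := digamma_ofReal_sub_log (y := (m : ℕ) * x) (by positivity)
    rw [Complex.ofReal_mul, Complex.ofReal_natCast] at h
    rw [h, zpow_one, one_mul]
  simpa using h1

end PolygammaSums

/-! ### The case `r ≥ 2`: isolating the pole -/

lemma analyticAt_comp_add_natCast {g : ℂ → ℂ} {p : ℂ} {l : ℕ} (hg : AnalyticAt ℂ g (p + l)) :
    AnalyticAt ℂ (fun s => g (s + l)) p :=
  AnalyticAt.fun_comp (g := g) (f := fun s => s + (l : ℂ)) hg (by fun_prop)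

lemma Meromorphic.comp_add_natCast {g : ℂ → ℂ} (hg : Meromorphic g) (l : ℕ) :
    Meromorphic fun s => g (s + l) := fun s =>
  (hg (s + l)).comp_analyticAt (g := fun s => s + (l : ℂ)) (by fun_prop)

/-- The part of `Θ(Q + 2, s, T + 1, x)` that is analytic at `s = -T`. -/
def thetaRegularPart (Q T : ℕ) (x : ℝ) (s : ℂ) : ℂ :=
  ∑ i ∈ Finset.range Q, ((-1) ^ (i + 1) * ((T + (i + 1)).choose (i + 1) : ℂ)
      * (1 / (x : ℂ) ^ (T + 1 + (i + 1))) * riemannZeta ((Q + 1 + 1 - (i + 1) : ℕ) : ℂ))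
      * riemannZeta (s + (T + 1 + (i + 1) : ℕ))
    + ∑ j ∈ Finset.range T, ((-1) ^ (Q + 1 + 1) * ((Q + 1 + j).choose j : ℂ)
      * (1 / (x : ℂ) ^ (Q + 1 + 1 + j)))
      * LSeries (fun m => (shiftedPowSum (T + 1 - j) (m * x) : ℂ)) (s + (Q + 1 + 1 + j : ℕ))
    + ((-1) ^ (Q + 1) * ((T + (Q + 1)).choose (Q + 1) : ℂ) * (1 / (x : ℂ) ^ (T + (Q + 1) + 1)))
      * LSeries (fun m => (shiftedHarmonic (m * x) : ℂ)) (s + (T + (Q + 1) + 1 : ℕ))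

/-- At `s = -T` the zeta functions are evaluated at `i + 2 ≠ 1`, the series of `S_{T+1-j}` at `Q + 2
+ j - T > 2 - (T + 1 - j)`, and the series of `h` at `Q + 2 > 3 / 2`. -/
lemma analyticAt_thetaRegularPart (Q T : ℕ) {x : ℝ} (hx : 0 < x) :
    AnalyticAt ℂ (thetaRegularPart Q T x) (1 - ((T + 1 : ℕ) : ℂ)) := by
  have h1 : AnalyticAt ℂ (fun s => ∑ i ∈ Finset.range Q,
      ((-1) ^ (i + 1) * ((T + (i + 1)).choose (i + 1) : ℂ)
      * (1 / (x : ℂ) ^ (T + 1 + (i + 1))) * riemannZeta ((Q + 1 + 1 - (i + 1) : ℕ) : ℂ))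
      * riemannZeta (s + (T + 1 + (i + 1) : ℕ))) (1 - ((T + 1 : ℕ) : ℂ)) := by
    refine Finset.analyticAt_fun_sum _ fun i _ => analyticAt_const.mul
      (analyticAt_comp_add_natCast (analyticAt_riemannZeta ?_))
    have e : 1 - ((T + 1 : ℕ) : ℂ) + ((T + 1 + (i + 1) : ℕ) : ℂ) = ((i + 2 : ℕ) : ℂ) := by
      push_cast
      ring
    rw [e]
    exact_mod_cast (by omega : i + 2 ≠ 1)
  have h2 : AnalyticAt ℂ (fun s => ∑ j ∈ Finset.range T,
      ((-1) ^ (Q + 1 + 1) * ((Q + 1 + j).choose j : ℂ) * (1 / (x : ℂ) ^ (Q + 1 + 1 + j)))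
      * LSeries (fun m => (shiftedPowSum (T + 1 - j) (m * x) : ℂ)) (s + (Q + 1 + 1 + j : ℕ)))
      (1 - ((T + 1 : ℕ) : ℂ)) := by
    refine Finset.analyticAt_fun_sum _ fun j hj => analyticAt_const.mul
      (analyticAt_comp_add_natCast ?_)
    have hj := Finset.mem_range.1 hj
    refine (analyticAt_LSeries_shiftedPowSum hx (by omega) ?_).1
    rw [Nat.cast_sub (by omega)]
    have : (0 : ℝ) ≤ Q := by positivity
    simp
    linarith
  have h3 : AnalyticAt ℂ (fun s : ℂ => ((-1) ^ (Q + 1) * ((T + (Q + 1)).choose (Q + 1) : ℂ)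
      * (1 / (x : ℂ) ^ (T + (Q + 1) + 1)))
      * LSeries (fun m => (shiftedHarmonic (m * x) : ℂ)) (s + (T + (Q + 1) + 1 : ℕ)))
      (1 - ((T + 1 : ℕ) : ℂ)) := by
    refine analyticAt_const.mul (analyticAt_comp_add_natCast ?_)
    refine (analyticAt_LSeries_shiftedHarmonic hx ?_).1
    have : (0 : ℝ) ≤ Q := by positivity
    simp
    linarith
  exact (h1.add h2).add h3

lemma one_div_pow_eq_zpow_neg (x : ℝ) (t : ℕ) : 1 / (x : ℂ) ^ t = (x : ℂ) ^ (-(t : ℤ)) := by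
  rw [zpow_neg, zpow_natCast, one_div]

lemma thetaSeries_eq_riemannZeta_add (Q T : ℕ) {x : ℝ} (hx : 0 < x) {s : ℂ}
    (hs : 1 - ((T + 1 : ℕ) : ℝ) < s.re) :
    thetaSeries ((Q + 2 : ℕ) : ℂ) s ((T + 1 : ℕ) : ℂ) x
      = (x : ℂ) ^ (-((T + 1 : ℕ) : ℤ)) * riemannZeta ((Q + 2 : ℕ) : ℂ)
          * riemannZeta (s + (T + 1 : ℕ)) + thetaRegularPart Q T x s := by
  have hs' : -(T : ℝ) < s.re := by
    push_cast at hs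
    linarith
  have hQ : (0 : ℝ) ≤ Q := by positivity
  have h1 : LSeriesHasSum (∑ i ∈ Finset.range (Q + 1), ((-1) ^ i * ((T + i).choose i : ℂ)
      * (1 / (x : ℂ) ^ (T + 1 + i)) * riemannZeta ((Q + 1 + 1 - i : ℕ) : ℂ))
        • fun m : ℕ => ((m : ℂ) ^ (T + 1 + i))⁻¹) s _ :=
    LSeriesHasSum.sum fun i _ => (LSeriesHasSum_inv_pow (by
      have : (0 : ℝ) ≤ i := by positivity
      simp
      linarith)).smul _
  have h2 : LSeriesHasSum (∑ j ∈ Finset.range T, ((-1) ^ (Q + 1 + 1) * ((Q + 1 + j).choose j : ℂ)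
      * (1 / (x : ℂ) ^ (Q + 1 + 1 + j)))
        • fun m : ℕ => (((m : ℂ) ^ (Q + 1 + 1 + j))⁻¹
          * (shiftedPowSum (T + 1 - j) (m * x) : ℂ))) s _ :=
    LSeriesHasSum.sum fun j hj => (LSeriesHasSum_inv_pow_mul.2
      (analyticAt_LSeries_shiftedPowSum hx (by have := Finset.mem_range.1 hj; omega) (by
        have hj := Finset.mem_range.1 hj
        rw [Nat.cast_sub (by omega)]
        simp
        linarith)).2).smul _
  have h3 := (LSeriesHasSum_inv_pow_mul.2 (analyticAt_LSeries_shiftedHarmonic (x := x)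
    (s := s + (T + (Q + 1) + 1 : ℕ)) hx (by simp; linarith)).2).smul
    ((-1) ^ (Q + 1) * ((T + (Q + 1)).choose (Q + 1) : ℂ) * (1 / (x : ℂ) ^ (T + (Q + 1) + 1)))
  have h4 := (hasSum_thetaTerm (r := Q + 2) (t := T + 1) (by omega) (by omega) hx hs).2
  have h5 := HasSum.unique h4 ((LSeriesHasSum_congr
    (g := fun m => (thetaCoeff (Q + 2) (T + 1) x m : ℂ)) s _ fun {m} hm => by
      rw [thetaCoeff_succ_eq (Q + 1) T hx hm]
      simp only [Pi.add_apply, Finset.sum_apply, Pi.smul_apply, smul_eq_mul]).1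
        ((h1.add h2).add h3))
  -- The split-off term `i = 0` carries `ζ(s + T + 1)`, the only factor singular at `s = -T`.
  rw [h5, Finset.sum_range_succ', thetaRegularPart, ← one_div_pow_eq_zpow_neg]
  simp only [pow_zero, add_zero, Nat.choose_zero_right, Nat.cast_one, one_mul, tsub_zero]
  ring

/-! ### The case `r = 1`: isolating the double pole -/

/-- The part of `Θ(1, s, T + 1, x)` that is analytic at `s = -T`. -/
def thetaOneRegularPart (T : ℕ) (x : ℝ) (s : ℂ) : ℂ :=
  -∑ j ∈ Finset.range T, (1 / (x : ℂ) ^ (j + 1))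
      * LSeries (fun m => (powSumRemainder (T + 1 - j) (m * x) : ℂ)) (s + (j + 1 : ℕ))
    + ((T + 1 : ℕ) : ℂ) * (1 / (x : ℂ) ^ (T + 2)) * riemannZeta (s + (T + 2 : ℕ))
    + (1 / (x : ℂ) ^ (T + 1))
      * LSeries (fun m => (digammaRemainder (m * x) : ℂ)) (s + (T + 1 : ℕ))

lemma analyticAt_thetaOneRegularPart (T : ℕ) {x : ℝ} (hx : 0 < x) :
    AnalyticAt ℂ (thetaOneRegularPart T x) (1 - ((T + 1 : ℕ) : ℂ)) := by
  have h1 : AnalyticAt ℂ (fun s => ∑ j ∈ Finset.range T, (1 / (x : ℂ) ^ (j + 1))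
      * LSeries (fun m => (powSumRemainder (T + 1 - j) (m * x) : ℂ)) (s + (j + 1 : ℕ)))
      (1 - ((T + 1 : ℕ) : ℂ)) := by
    refine Finset.analyticAt_fun_sum _ fun j hj => analyticAt_const.mul
      (analyticAt_comp_add_natCast ?_)
    have hj := Finset.mem_range.1 hj
    refine (analyticAt_LSeries_powSumRemainder hx (by omega) ?_).1
    rw [Nat.cast_sub (by omega)]
    simp
    linarith
  have h2 : AnalyticAt ℂ (fun s : ℂ => ((T + 1 : ℕ) : ℂ) * (1 / (x : ℂ) ^ (T + 2))
      * riemannZeta (s + (T + 2 : ℕ))) (1 - ((T + 1 : ℕ) : ℂ)) := by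
    refine analyticAt_const.mul (analyticAt_comp_add_natCast (analyticAt_riemannZeta ?_))
    have e : 1 - ((T + 1 : ℕ) : ℂ) + ((T + 2 : ℕ) : ℂ) = ((2 : ℕ) : ℂ) := by
      push_cast
      ring
    rw [e]
    norm_num
  have h3 : AnalyticAt ℂ (fun s : ℂ => (1 / (x : ℂ) ^ (T + 1))
      * LSeries (fun m => (digammaRemainder (m * x) : ℂ)) (s + (T + 1 : ℕ)))
      (1 - ((T + 1 : ℕ) : ℂ)) := by
    refine analyticAt_const.mul (analyticAt_comp_add_natCast ?_)
    exact (analyticAt_LSeries_digammaRemainder hx (by simp)).1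
  exact (h1.neg.add h2).add h3

lemma harmonic_eq_sum_sub (T : ℕ) :
    ((harmonic T : ℚ) : ℂ) = ∑ j ∈ Finset.range T, 1 / ((T - j : ℕ) : ℂ) := by
  rw [← Finset.sum_range_reflect, harmonic]
  push_cast
  refine Finset.sum_congr rfl fun j hj => ?_
  have hj := Finset.mem_range.1 hj
  rw [show T - (T - 1 - j) = j + 1 by omega, one_div]
  push_cast
  rfl

/-- Each `S_k(y)` is replaced by `powSumRemainder k y + 1 / ((k - 1) y ^ (k - 1)) - 1 / y ^ k` with
`k = T + 1 - j`, `y = m x`. The middle terms carry the factors `1 / (T - j)`, which add up to `H_T`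
at order `y ^ (-T-1)`. The last terms give `T` copies of `y ^ (-T-2)`, and the `1 / y` inside
`digammaRemainder` gives one more: this is the source of `t ζ(2)`. -/
lemma thetaCoeff_one_succ_eq (T : ℕ) {x : ℝ} (hx : 0 < x) {m : ℕ} (hm : m ≠ 0) :
    (thetaCoeff 1 (T + 1) x m : ℂ)
      = (1 / (x : ℂ) ^ (T + 1)) * (((m : ℂ) ^ (T + 1))⁻¹ * Complex.log m)
        + (1 / (x : ℂ) ^ (T + 1)) * ((Real.eulerMascheroniConstant : ℂ) + (Real.log x : ℂ)
          - ((harmonic T : ℚ) : ℂ)) * ((m : ℂ) ^ (T + 1))⁻¹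
        + (-∑ j ∈ Finset.range T, (1 / (x : ℂ) ^ (j + 1))
            * (((m : ℂ) ^ (j + 1))⁻¹ * (powSumRemainder (T + 1 - j) (m * x) : ℂ))
          + ((T + 1 : ℕ) : ℂ) * (1 / (x : ℂ) ^ (T + 2)) * ((m : ℂ) ^ (T + 2))⁻¹
          + (1 / (x : ℂ) ^ (T + 1))
            * (((m : ℂ) ^ (T + 1))⁻¹ * (digammaRemainder (m * x) : ℂ))) := by
  have hm' : (m : ℂ) ≠ 0 := by exact_mod_cast hm
  have hmr : (m : ℝ) ≠ 0 := by exact_mod_cast hm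
  have hx' : (x : ℂ) ≠ 0 := by exact_mod_cast hx.ne'
  have h0 := thetaCoeff_succ_eq 0 T hx hm
  have h1 : ∑ j ∈ Finset.range T, (1 / (x : ℂ) ^ (j + 1))
      * (((m : ℂ) ^ (j + 1))⁻¹ * (powSumRemainder (T + 1 - j) (m * x) : ℂ))
      = ∑ j ∈ Finset.range T, (1 / (x : ℂ) ^ (j + 1))
        * (((m : ℂ) ^ (j + 1))⁻¹ * (shiftedPowSum (T + 1 - j) (m * x) : ℂ))
        + T * (1 / (x : ℂ) ^ (T + 2)) * ((m : ℂ) ^ (T + 2))⁻¹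
        - (1 / (x : ℂ) ^ (T + 1)) * ((m : ℂ) ^ (T + 1))⁻¹ * ((harmonic T : ℚ) : ℂ) := by
    have e1 : (T : ℂ) * (1 / (x : ℂ) ^ (T + 2)) * ((m : ℂ) ^ (T + 2))⁻¹
        = ∑ j ∈ Finset.range T, (1 / (x : ℂ) ^ (T + 2)) * ((m : ℂ) ^ (T + 2))⁻¹ := by
      rw [Finset.sum_const, Finset.card_range, nsmul_eq_mul]
      ring
    rw [harmonic_eq_sum_sub, Finset.mul_sum, e1, ← Finset.sum_add_distrib,
      ← Finset.sum_sub_distrib]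
    refine Finset.sum_congr rfl fun j hj => ?_
    have hj := Finset.mem_range.1 hj
    obtain ⟨k, hk⟩ : ∃ k, T = j + 1 + k := ⟨T - j - 1, by omega⟩
    have hk' : (k : ℂ) + 1 ≠ 0 := by exact_mod_cast Nat.succ_ne_zero k
    subst hk
    rw [powSumRemainder, show j + 1 + k + 1 - j = k + 2 by omega, show k + 2 - 1 = k + 1 by omega,
      show j + 1 + k - j = k + 1 by omega]
    push_cast
    simp only [mul_pow, pow_add]
    field_simp
  rw [zero_add] at h0
  rw [h0, h1, digammaRemainder, Real.log_mul hmr hx.ne', ← Complex.natCast_log, Finset.sum_range_zero]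
  have h2 : ∑ j ∈ Finset.range T, ((-1) ^ 1 * ((0 + j).choose j : ℂ)
      * (1 / (x : ℂ) ^ (1 + j)))
      * (((m : ℂ) ^ (1 + j))⁻¹ * (shiftedPowSum (T + 1 - j) (m * x) : ℂ))
      = -∑ j ∈ Finset.range T, (1 / (x : ℂ) ^ (j + 1))
        * (((m : ℂ) ^ (j + 1))⁻¹ * (shiftedPowSum (T + 1 - j) (m * x) : ℂ)) := by
    rw [← Finset.sum_neg_distrib]
    refine Finset.sum_congr rfl fun j _ => ?_
    rw [zero_add, Nat.choose_self, add_comm 1 j]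
    push_cast
    ring
  rw [h2]
  push_cast
  simp only [add_zero, pow_zero, Nat.choose_zero_right, Nat.cast_one]
  have e3 : (1 / (x : ℂ) ^ (T + 1)) * ((m : ℂ) ^ (T + 1))⁻¹ * (1 / ((m : ℂ) * x))
      = (1 / (x : ℂ) ^ (T + 2)) * ((m : ℂ) ^ (T + 2))⁻¹ := by
    simp only [pow_succ]
    field_simp
  linear_combination e3

lemma thetaSeries_one_eq_riemannZeta_add (T : ℕ) {x : ℝ} (hx : 0 < x) {s : ℂ}
    (hs : 1 - ((T + 1 : ℕ) : ℝ) < s.re) :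
    thetaSeries ((1 : ℕ) : ℂ) s ((T + 1 : ℕ) : ℂ) x
      = (1 / (x : ℂ) ^ (T + 1)) * -deriv riemannZeta (s + (T + 1 : ℕ))
        + (1 / (x : ℂ) ^ (T + 1)) * ((Real.eulerMascheroniConstant : ℂ) + (Real.log x : ℂ)
          - ((harmonic T : ℚ) : ℂ)) * riemannZeta (s + (T + 1 : ℕ))
        + thetaOneRegularPart T x s := by
  have hs' : -(T : ℝ) < s.re := by
    push_cast at hs
    linarith
  have h1 := (LSeriesHasSum_inv_pow_mul_log (k := T + 1) (s := s) (by simp; linarith)).smul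
    (1 / (x : ℂ) ^ (T + 1))
  have h2 := (LSeriesHasSum_inv_pow (k := T + 1) (s := s) (by simp; linarith)).smul
    ((1 / (x : ℂ) ^ (T + 1)) * ((Real.eulerMascheroniConstant : ℂ) + (Real.log x : ℂ)
          - ((harmonic T : ℚ) : ℂ)))
  have h3 : LSeriesHasSum (∑ j ∈ Finset.range T, (1 / (x : ℂ) ^ (j + 1))
        • fun m : ℕ => (((m : ℂ) ^ (j + 1))⁻¹
          * (powSumRemainder (T + 1 - j) (m * x) : ℂ))) s _ :=
    LSeriesHasSum.sum fun j hj => (LSeriesHasSum_inv_pow_mul.2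
      (analyticAt_LSeries_powSumRemainder hx (by have := Finset.mem_range.1 hj; omega) (by
        have hj := Finset.mem_range.1 hj
        rw [Nat.cast_sub (by omega)]
        simp
        linarith)).2).smul _
  have h4 := (LSeriesHasSum_inv_pow (k := T + 2) (s := s) (by simp; linarith)).smul
    (((T + 1 : ℕ) : ℂ) * (1 / (x : ℂ) ^ (T + 2)))
  have h5 := (LSeriesHasSum_inv_pow_mul.2 (analyticAt_LSeries_digammaRemainder (x := x)
    (s := s + (T + 1 : ℕ)) hx (by simp; linarith)).2).smul (1 / (x : ℂ) ^ (T + 1))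
  have h6 := (hasSum_thetaTerm (r := 1) (t := T + 1) le_rfl (by omega) hx hs).2
  have h7 := HasSum.unique h6 ((LSeriesHasSum_congr
    (g := fun m => (thetaCoeff 1 (T + 1) x m : ℂ)) s _ fun {m} hm => by
      rw [thetaCoeff_one_succ_eq T hx hm]
      simp only [Pi.add_apply, Pi.neg_apply, Finset.sum_apply, Pi.smul_apply, smul_eq_mul]).1
        ((h1.add h2).add ((h3.neg.add h4).add h5)))
  rw [h7, thetaOneRegularPart]

/-! ### Matching the constants with the stated expansions -/

lemma sum_Icc_one_eq_sum_range (f : ℕ → ℂ) (Q : ℕ) :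
    ∑ i ∈ Finset.Icc 1 Q, f i = ∑ i ∈ Finset.range Q, f (i + 1) := by
  induction Q with
  | zero => simp
  | succ Q ih => rw [Finset.sum_Icc_succ_top (by omega), ih, Finset.sum_range_succ]

end

theorem theorem7 (x : ℝ) (hx : 0 < x) :
    -- the case `r ≥ 2`, `t ≥ 0`
    (∀ r t : ℕ, 2 ≤ r →
      (∀ s : ℂ, (((r : ℂ), s, (t : ℂ)) : ℂ × ℂ × ℂ) ∈ convergenceRegion →
        Summable (thetaTerm r s t x)) ∧
      (∃ F : ℂ → ℂ, IsThetaContinuation r t x F) ∧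
      (∀ j ∈ Finset.range (t - 1), Summable fun m : ℕ+ =>
        polygamma (t - j - 1) ((m : ℂ) * x + 1) / (m : ℂ) ^ ((r : ℤ) + j - t + 1)) ∧
      (Summable fun m : ℕ+ =>
        ((Real.eulerMascheroniConstant : ℂ) + Complex.digamma ((m : ℂ) * x + 1)) / (m : ℂ) ^ r) ∧
      ∀ F : ℂ → ℂ, IsThetaContinuation r t x F →
        meromorphicOrderAt F (1 - (t : ℂ)) = ((-1 : ℤ) : WithTop ℤ) ∧
        (fun s : ℂ => F s -
          ((x : ℂ) ^ (-(t : ℤ)) * riemannZeta r / (s - (1 - (t : ℂ))) +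
            ((Real.eulerMascheroniConstant : ℂ) * riemannZeta r * (x : ℂ) ^ (-(t : ℤ))
              + (-1) ^ r * ∑ j ∈ Finset.range (t - 1),
                  ((j + r - 1).choose j : ℂ) * ((-1) ^ (t - j) / ((t - j - 1).factorial : ℂ))
                    * (1 / (x : ℂ) ^ (j + r))
                    * ∑' m : ℕ+, polygamma (t - j - 1) ((m : ℂ) * x + 1)
                        / (m : ℂ) ^ ((r : ℤ) + j - t + 1)
              + ∑ i ∈ Finset.Icc 1 (r - 2),
                  (-1) ^ i / (x : ℂ) ^ (t + i) * ((i + t - 1).choose i : ℂ)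
                    * riemannZeta ((i : ℂ) + 1) * riemannZeta ((r : ℂ) - i)
              - (-1) ^ r / (x : ℂ) ^ (r + t - 1) * (binomPred r t : ℂ)
                  * ∑' m : ℕ+, ((Real.eulerMascheroniConstant : ℂ)
                      + Complex.digamma ((m : ℂ) * x + 1)) / (m : ℂ) ^ r)))
          =O[𝓝[≠] (1 - (t : ℂ))] fun s : ℂ => s - (1 - (t : ℂ))) ∧
    -- the case `r = 1`, `t ≥ 1`
    (∀ t : ℕ, 1 ≤ t →
      (∀ s : ℂ, (((1 : ℂ), s, (t : ℂ)) : ℂ × ℂ × ℂ) ∈ convergenceRegion →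
        Summable (thetaTerm 1 s t x)) ∧
      (∃ F : ℂ → ℂ, IsThetaContinuation 1 t x F) ∧
      (∀ j ∈ Finset.range (t - 1), Summable fun m : ℕ+ =>
        (polygamma (t - j - 1) ((m : ℂ) * x)
            - (-1) ^ (t - j) * ((t - j - 2).factorial : ℂ) / ((m : ℂ) * x) ^ (t - j - 1))
          / (m : ℂ) ^ ((j : ℤ) - t + 2)) ∧
      (Summable fun m : ℕ+ =>
        (Complex.digamma ((m : ℂ) * x) - (Real.log ((m : ℝ) * x) : ℂ)) / (m : ℂ)) ∧
      ∀ F : ℂ → ℂ, IsThetaContinuation 1 t x F →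
        meromorphicOrderAt F (1 - (t : ℂ)) = ((-2 : ℤ) : WithTop ℤ) ∧
        (fun s : ℂ => F s -
          ((x : ℂ) ^ (-(t : ℤ)) / (s - (1 - (t : ℂ))) ^ 2 +
            (x : ℂ) ^ (-(t : ℤ)) / (s - (1 - (t : ℂ)))
              * ((Real.eulerMascheroniConstant : ℂ) + (Real.log x : ℂ)
                  - ((harmonic (t - 1) : ℚ) : ℂ)) +
            (1 / (x : ℂ) ^ t
                * ((Real.eulerMascheroniConstant : ℂ)
                    * ((Real.eulerMascheroniConstant : ℂ) + (Real.log x : ℂ)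
                        - ((harmonic (t - 1) : ℚ) : ℂ))
                  + stieltjesOne)
              - ∑ j ∈ Finset.range (t - 1),
                  (-1) ^ (t - j) / ((t - j - 1).factorial : ℂ) * (1 / (x : ℂ) ^ (j + 1))
                    * ∑' m : ℕ+, (polygamma (t - j - 1) ((m : ℂ) * x)
                        - (-1) ^ (t - j) * ((t - j - 2).factorial : ℂ)
                            / ((m : ℂ) * x) ^ (t - j - 1))
                        / (m : ℂ) ^ ((j : ℤ) - t + 2)
              + (t : ℂ) * riemannZeta 2 / (x : ℂ) ^ (t + 1)
              + 1 / (x : ℂ) ^ t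
                  * ∑' m : ℕ+, (Complex.digamma ((m : ℂ) * x) - (Real.log ((m : ℝ) * x) : ℂ))
                      / (m : ℂ))))
          =O[𝓝[≠] (1 - (t : ℂ))] fun s : ℂ => s - (1 - (t : ℂ))) := by
  have hx' : (x : ℂ) ≠ 0 := by exact_mod_cast hx.ne'
  refine ⟨fun r t hr => ⟨fun s hs => ?_, exists_isThetaContinuation (by omega) (by omega) hx,
    fun j hj => (hasSum_polygamma_add_one hx hr hj).summable,
    (hasSum_eulerMascheroni_add_digamma hx hr).summable, fun F hF => ?_⟩,
    fun t ht => ⟨fun s hs => ?_, ?_, fun j hj => (hasSum_polygamma_sub hx hj).summable,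
    (hasSum_digamma_sub_log hx).summable, fun F hF => ?_⟩⟩
  · exact (hasSum_thetaTerm (by omega) (by omega) hx
      ((mem_convergenceRegion_iff (by omega) (by omega)).1 hs)).1
  -- The residue is nonzero because `ζ` does not vanish to the right of `1`; this makes the pole
  -- order exactly one.
  · have ha : (x : ℂ) ^ (-(t : ℤ)) * riemannZeta r ≠ 0 := by
      refine mul_ne_zero (zpow_ne_zero _ hx') (riemannZeta_ne_zero_of_one_lt_re ?_)
      rw [Complex.natCast_re]
      exact_mod_cast hr
    rcases t with _ | T
    -- For `t = 0` the double series factors as `ζ(r) ζ(s)`. In the stated constant only `γ ζ(r)`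
    -- survives: the sum over `j` is empty, the binomials `(i - 1).choose i` vanish for `i ≥ 1`, and
    -- `binomPred r 0 = 0`.
    · refine simplePole_of_riemannZeta (H₀ := fun _ => 0) ha (hF.meromorphic _) analyticAt_const
        (hF.eventuallyEq (by omega) (by omega) ?_ fun s hs => ?_) ?_
      · have := meromorphic_riemannZeta (1 - ((0 : ℕ) : ℂ))
        simp only [Nat.cast_zero, add_zero, sub_zero] at this ⊢
        fun_prop
      · have h1 := (hasSum_thetaTerm (r := r) (t := 0) (by omega) (by omega) hx hs).2
        have h2 := (LSeriesHasSum_one (s := s) (by simpa using hs)).smul (riemannZeta r)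
        have h3 := HasSum.unique h1 ((LSeriesHasSum_congr
          (g := fun m => (thetaCoeff r 0 x m : ℂ)) s _ fun {m} _ => by
            rw [thetaCoeff_zero hr]
            simp).1 h2)
        rw [h3]
        simp
      · have h1 : ∑ i ∈ Finset.Icc 1 (r - 2),
            (-1) ^ i / (x : ℂ) ^ (0 + i) * ((i + 0 - 1).choose i : ℂ)
              * riemannZeta ((i : ℂ) + 1) * riemannZeta ((r : ℂ) - i) = 0 := by
          refine Finset.sum_eq_zero fun i hi => ?_
          rw [Nat.choose_eq_zero_of_lt (by have := (Finset.mem_Icc.1 hi).1; omega)]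
          simp
        rw [h1]
        simp [binomPred]
        ring
    · obtain ⟨Q, rfl⟩ : ∃ Q, r = Q + 2 := ⟨r - 2, by omega⟩
      refine simplePole_of_riemannZeta (H₀ := thetaRegularPart Q T x) ha (hF.meromorphic _)
        (analyticAt_thetaRegularPart Q T hx)
        (hF.eventuallyEq (by omega) (by omega) ?_ fun s hs =>
          (thetaSeries_eq_riemannZeta_add Q T hx hs).symm) ?_
      · exact ((MeromorphicAt.const _ _).mul
          (meromorphic_riemannZeta.comp_add_natCast (T + 1) _)).add
          (analyticAt_thetaRegularPart Q T hx).meromorphicAt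
      · rw [thetaRegularPart, (hasSum_eulerMascheroni_add_digamma hx hr).tsum_eq,
          sum_Icc_one_eq_sum_range, Finset.mul_sum]
        have h1 : ∀ i ∈ Finset.range Q, (-1) ^ (i + 1) / (x : ℂ) ^ (T + 1 + (i + 1))
            * ((i + 1 + (T + 1) - 1).choose (i + 1) : ℂ) * riemannZeta (((i + 1 : ℕ) : ℂ) + 1)
            * riemannZeta (((Q + 2 : ℕ) : ℂ) - ((i + 1 : ℕ) : ℂ))
            = ((-1) ^ (i + 1) * ((T + (i + 1)).choose (i + 1) : ℂ)
              * (1 / (x : ℂ) ^ (T + 1 + (i + 1))) * riemannZeta ((Q + 1 + 1 - (i + 1) : ℕ) : ℂ))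
              * riemannZeta (1 - ((T + 1 : ℕ) : ℂ) + (T + 1 + (i + 1) : ℕ)) := by
          intro i hi
          have hi := Finset.mem_range.1 hi
          rw [show i + 1 + (T + 1) - 1 = T + (i + 1) by omega, Nat.cast_sub (by omega),
            show 1 - ((T + 1 : ℕ) : ℂ) + (T + 1 + (i + 1) : ℕ) = ((i + 1 : ℕ) : ℂ) + 1 by
              push_cast; ring]
          ring
        have h2 : ∀ j ∈ Finset.range (T + 1 - 1), (-1) ^ (Q + 2)
            * (((j + (Q + 2) - 1).choose j : ℂ)
              * ((-1) ^ (T + 1 - j) / ((T + 1 - j - 1).factorial : ℂ)) * (1 / (x : ℂ) ^ (j + (Q + 2)))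
              * ∑' m : ℕ+, polygamma (T + 1 - j - 1) ((m : ℂ) * x + 1)
                  / (m : ℂ) ^ (((Q + 2 : ℕ) : ℤ) + j - ((T + 1 : ℕ) : ℤ) + 1))
            = ((-1) ^ (Q + 1 + 1) * ((Q + 1 + j).choose j : ℂ) * (1 / (x : ℂ) ^ (Q + 1 + 1 + j)))
              * LSeries (fun m => (shiftedPowSum (T + 1 - j) (m * x) : ℂ))
                (1 - ((T + 1 : ℕ) : ℂ) + (Q + 1 + 1 + j : ℕ)) := by
          intro j hj
          have hf : ((T + 1 - j - 1).factorial : ℂ) ≠ 0 := by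
            exact_mod_cast Nat.factorial_ne_zero _
          -- The sign and factorial in the stated coefficient cancel those relating `ψ^(t-j-1)` to
          -- `S_{t-j}`, since the sign squares to `1`.
          have hs : ((-1 : ℂ) ^ (T + 1 - j)) * (-1) ^ (T + 1 - j) = 1 := by
            rw [← mul_pow]
            simp
          rw [(hasSum_polygamma_add_one hx hr hj).tsum_eq,
            show j + (Q + 2) - 1 = Q + 1 + j by omega, show j + (Q + 2) = Q + 1 + 1 + j by omega,
            show 1 - ((T + 1 : ℕ) : ℂ) + (Q + 1 + 1 + j : ℕ)
              = ((((Q + 2 : ℕ) : ℤ) + j - ((T + 1 : ℕ) : ℤ) + 1 : ℤ) : ℂ) by push_cast; ring]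
          generalize LSeries _ _ = L
          field_simp
          linear_combination ((Q + 1 + j).choose j : ℂ) * L * hs
        rw [Finset.sum_congr rfl h2, show Q + 2 - 2 = Q by omega, Finset.sum_congr rfl h1,
          show T + 1 - 1 = T by omega, binomPred, if_neg (Nat.succ_ne_zero T),
          show Q + 2 + (T + 1) - 2 = T + (Q + 1) by omega, show T + 1 - 1 = T by omega,
          Nat.choose_symm_add, show Q + 2 + (T + 1) - 1 = T + (Q + 1) + 1 by omega,
          show 1 - ((T + 1 : ℕ) : ℂ) + (T + (Q + 1) + 1 : ℕ) = ((Q + 2 : ℕ) : ℂ) by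
            push_cast; ring]
        ring
  · have hs' : (((1 : ℕ) : ℂ), s, (t : ℂ)) ∈ convergenceRegion := by
      rw [Nat.cast_one]
      exact hs
    have := (hasSum_thetaTerm (r := 1) le_rfl (by omega) hx
      ((mem_convergenceRegion_iff (r := 1) le_rfl (by omega)).1 hs')).1
    rwa [Nat.cast_one] at this
  · have := exists_isThetaContinuation (r := 1) (t := t) le_rfl (by omega) hx
    rwa [Nat.cast_one] at this
  · have hF' : IsThetaContinuation ((1 : ℕ) : ℂ) t x F := by
      rw [Nat.cast_one]
      exact hF
    obtain ⟨T, rfl⟩ : ∃ T, t = T + 1 := ⟨t - 1, by omega⟩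
    rw [show T + 1 - 1 = T by omega, ← one_div_pow_eq_zpow_neg]
    refine doublePole_of_riemannZeta (H₀ := thetaOneRegularPart T x)
      (one_div_ne_zero (pow_ne_zero _ hx')) (hF.meromorphic _)
      (analyticAt_thetaOneRegularPart T hx)
      (hF'.eventuallyEq le_rfl (by omega) ?_ fun s hs =>
        (thetaSeries_one_eq_riemannZeta_add T hx hs).symm) ?_
    · have h1 := meromorphic_riemannZeta.comp_add_natCast (T + 1)
      have h2 := meromorphic_riemannZeta.deriv.comp_add_natCast (T + 1)
      exact (((MeromorphicAt.const _ _).mul (h2 _).neg).add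
        ((MeromorphicAt.const _ _).mul (h1 _))).add
        (analyticAt_thetaOneRegularPart T hx).meromorphicAt
    · rw [thetaOneRegularPart, (hasSum_digamma_sub_log hx).tsum_eq]
      have h2 : ∀ j ∈ Finset.range T, (-1) ^ (T + 1 - j) / ((T + 1 - j - 1).factorial : ℂ)
          * (1 / (x : ℂ) ^ (j + 1))
          * ∑' m : ℕ+, (polygamma (T + 1 - j - 1) ((m : ℂ) * x)
              - (-1) ^ (T + 1 - j) * ((T + 1 - j - 2).factorial : ℂ)
                / ((m : ℂ) * x) ^ (T + 1 - j - 1)) / (m : ℂ) ^ ((j : ℤ) - ((T + 1 : ℕ) : ℤ) + 2)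
          = (1 / (x : ℂ) ^ (j + 1))
            * LSeries (fun m => (powSumRemainder (T + 1 - j) (m * x) : ℂ))
              (1 - ((T + 1 : ℕ) : ℂ) + (j + 1 : ℕ)) := by
        intro j hj
        have hf : ((T + 1 - j - 1).factorial : ℂ) ≠ 0 := by
          exact_mod_cast Nat.factorial_ne_zero _
        -- The same cancellation of sign and factorial, now against `powSumRemainder`.
        have hs : ((-1 : ℂ) ^ (T + 1 - j)) * (-1) ^ (T + 1 - j) = 1 := by
          rw [← mul_pow]
          simp
        rw [(hasSum_polygamma_sub (t := T + 1) hx hj).tsum_eq,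
          show 1 - ((T + 1 : ℕ) : ℂ) + (j + 1 : ℕ)
            = (((j : ℤ) - ((T + 1 : ℕ) : ℤ) + 2 : ℤ) : ℂ) by push_cast; ring]
        generalize LSeries _ _ = L
        field_simp
        linear_combination L * hs
      rw [Finset.sum_congr rfl h2,
        show 1 - ((T + 1 : ℕ) : ℂ) + (T + 2 : ℕ) = 2 by push_cast; ring,
        show 1 - ((T + 1 : ℕ) : ℂ) + (T + 1 : ℕ) = 1 by push_cast; ring]
      ring
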